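/- Theorem 3.3 (Steele type inequality). Let $(\mathcal M,\tau)$ be a noncommutative probability space, i.e. a von Neumann algebra $\mathcal M$ with a normal faithful trace $\tau$ such that $\tau(1)=1$. Let $L_p(\mathcal M)$ $(p=1,2)$ be the completion of $\mathcal M$ in the norm $\|x\|_p=\tau(|x|^p)^{1/p}$; regard $L_2(\mathcal M)\subseteq L_1(\mathcal M)$, and for a von Neumann subalgebra $\mathcal N\subseteq\mathcal M$ (containing $1$) regard $L_1(\mathcal N)$ as the $\|\cdot\|_1$-closure of $\mathcal N$ in $L_1(\mathcal M)$. The trace and the adjoint are extended continuously to $L_1(\mathcal M)$, and $L_1(\mathcal M)_{sa}$ is the set of self-adjoint elements. For $z\in L_1(\mathcal M)_{sa}$ let $\tau(z^2)\in[0,\infty]$ be $\|z\|_2^2$ if $z\in L_2(\mathcal M)$ and $\infty$ otherwise, and let ${\rm var}(z)=\tau\big((z-\tau(z)1)^2\big)$. $W^*(S)$ denotes the von Neumann algebra generated by $S$. Let $n\ge 1$ and let $\mathcal N_1,\dots,\mathcal N_n$ be von Neumann subalgebras of $\mathcal M$ that are either freely independent, i.e. $\tau(a_1a_2\cdots a_m)=0$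 whenever $m\ge1$, $a_k\in\mathcal N_{i_k}$, $\tau(a_k)=0$ for all $k$, and $i_k\neq i_{k+1}$ for $1\le k<m$; or tensor independent, i.e. $\tau\big(\prod_{i=1}^m\prod_{k=1}^n a_{ki}\big)=\prod_{k=1}^n\tau\big(\prod_{i=1}^m a_{ki}\big)$ for all $m$ and all $a_{ki}\in\mathcal N_k$ (the noncommutative products being taken in increasing order of the index). Let $x_j\in L_1(\mathcal N_j)$ be self-adjoint, $1\le j\le n$. Let $f:L_1(\mathcal M)_{sa}^n\to L_1(\mathcal M)_{sa}$ be any function and $y=f(x_1,\dots,x_n)$. For each $j$ let $$f_j:\prod_{k\ne j}L_1(\mathcal N_k)\to L_1\Big(W^*\Big(\bigcup_{k\ne j}\mathcal N_k\Big)\Big)$$ be any function such that $y_j=f_j(x_1,\dots,x_{j-1},x_{j+1},\dots,x_n)$ is self-adjoint. Then $${\rm var}(y)\le\sum_{j=1}^n\tau\big((y-y_j)^2\big)\qquad\text{in }[0,\infty].$$ -/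

import Mathlib

open scoped InnerProductSpace ComplexOrder ENNReal Topology

noncomputable section

/-- The ultraweak (that is, σ-weak) topology of a von Neumann algebra `M ⊆ B(H)`: the coarsest
topology for which all the functionals `x ↦ ∑ᵢ ⟪ξᵢ, x ηᵢ⟫`, with `∑ᵢ ‖ξᵢ‖² < ∞` and
`∑ᵢ ‖ηᵢ‖² < ∞`, are continuous. -/
abbrev ultraweakTopology {H : Type*} [NormedAddCommGroup H] [InnerProductSpace ℂ H]
    [CompleteSpace H] (M : VonNeumannAlgebra H) : TopologicalSpace M.toStarSubalgebra :=
  ⨅ p : {p : (ℕ → H) × (ℕ → H) //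
      Summable (fun i => ‖p.1 i‖ ^ 2) ∧ Summable (fun i => ‖p.2 i‖ ^ 2)},
    TopologicalSpace.induced
      (fun x : M.toStarSubalgebra => ∑' i, ⟪p.1.1 i, (x : H →L[ℂ] H) (p.1.2 i)⟫_ℂ) inferInstance

/-- A noncommutative probability space: a von Neumann algebra `alg` acting on the Hilbert space `H`
with a normal (ultraweakly continuous) faithful positive tracial functional `tr`, `tr 1 = 1`. -/
structure NCProbabilitySpace (H : Type*) [NormedAddCommGroup H] [InnerProductSpace ℂ H]
    [CompleteSpace H] where
  /-- the von Neumann algebra -/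
  alg : VonNeumannAlgebra H
  /-- the trace -/
  tr : alg.toStarSubalgebra →ₗ[ℂ] ℂ
  tr_nonneg : ∀ x, 0 ≤ tr (star x * x)
  tr_faithful : ∀ x, tr (star x * x) = 0 → x = 0
  tr_mul_comm : ∀ x y, tr (x * y) = tr (y * x)
  tr_one : tr 1 = 1
  tr_normal : Continuous[ultraweakTopology alg, inferInstance] tr

/-- `W*(S)`, the von Neumann algebra generated by a set `S` of bounded operators: the double
commutant of `S ∪ S*`. -/
def generatedVN {H : Type*} [NormedAddCommGroup H] [InnerProductSpace ℂ H] [CompleteSpace H]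
    (S : Set (H →L[ℂ] H)) : VonNeumannAlgebra H where
  toStarSubalgebra :=
    StarSubalgebra.centralizer ℂ (StarSubalgebra.centralizer ℂ S : Set (H →L[ℂ] H))
  centralizer_centralizer' := by simp

namespace NCProbabilitySpace

variable {H : Type*} [NormedAddCommGroup H] [InnerProductSpace ℂ H] [CompleteSpace H]

/-- The elements of the von Neumann algebra of `P`. -/
abbrev Elt (P : NCProbabilitySpace H) : Type _ := P.alg.toStarSubalgebra

variable (P : NCProbabilitySpace H)

section modulus

theorem mem_of_commute {T : H →L[ℂ] H}
    (h : ∀ g ∈ P.alg.commutant, Commute g T) : T ∈ P.alg.toStarSubalgebra := by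
  have : T ∈ P.alg.commutant.commutant := by
    rw [VonNeumannAlgebra.mem_commutant_iff]
    exact fun g hg => h g hg
  rw [VonNeumannAlgebra.commutant_commutant] at this
  exact this

theorem commute_of_mem (x : P.Elt) {g : H →L[ℂ] H} (hg : g ∈ P.alg.commutant) :
    Commute g (x : H →L[ℂ] H) :=
  ((VonNeumannAlgebra.mem_commutant_iff.1 hg) x x.2).symm

theorem cfc_mem (x : P.Elt) (f : ℝ → ℝ) : cfc f (x : H →L[ℂ] H) ∈ P.alg.toStarSubalgebra :=
  P.mem_of_commute fun _ hg => ((P.commute_of_mem x hg).symm.cfc_real f).symm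

theorem sqrt_mem (x : P.Elt) : CFC.sqrt (x : H →L[ℂ] H) ∈ P.alg.toStarSubalgebra :=
  P.mem_of_commute fun _ hg => by
    rw [CFC.sqrt]
    exact ((P.commute_of_mem x hg).symm.cfcₙ_nnreal _).symm

/-- The modulus `|x| = (x* x)^{1/2}` of an element of the von Neumann algebra. -/
def modulus (x : P.Elt) : P.Elt :=
  ⟨CFC.abs (x : H →L[ℂ] H), P.sqrt_mem (star x * x)⟩

end modulus

section traceLemmas

theorem tr_star (x : P.Elt) : P.tr (star x) = starRingEnd ℂ (P.tr x) := by
  have h1 := (Complex.nonneg_iff.1 (P.tr_nonneg (1 + x))).2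
  have h2 := (Complex.nonneg_iff.1 (P.tr_nonneg (1 + Complex.I • x))).2
  have h3 := (Complex.nonneg_iff.1 (P.tr_nonneg x)).2
  have h0 := P.tr_one
  simp only [star_add, star_one, star_smul, add_mul, mul_add, one_mul, mul_one, map_add, h0,
    smul_mul_assoc, mul_smul_comm, map_smul, smul_eq_mul, Complex.add_im, Complex.mul_im,
    Complex.one_im, Complex.I_re, Complex.I_im, RCLike.star_def, Complex.conj_I,
    Complex.neg_re, Complex.neg_im, Complex.mul_re, ← h3] at h1 h2
  apply Complex.ext
  · simp only [Complex.conj_re]; linarith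
  · simp only [Complex.conj_im]; linarith

end traceLemmas

/-- `M` with the `2`-norm `‖x‖₂ = τ(|x|²)^{1/2} = τ(x* x)^{1/2}`. -/
def PreL2 : Type _ := P.Elt

instance : AddCommGroup P.PreL2 := inferInstanceAs (AddCommGroup P.Elt)
instance : Module ℂ P.PreL2 := inferInstanceAs (Module ℂ P.Elt)

/-- The identity map from `M` to `M` with the `2`-norm. -/
def toPreL2 : P.Elt ≃ₗ[ℂ] P.PreL2 := LinearEquiv.refl ℂ _

/-- The (pre-)inner product `⟨x, y⟩ = τ(x* y)` on `M`. -/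
abbrev preL2Core : PreInnerProductSpace.Core ℂ P.PreL2 where
  inner x y := P.tr (star (P.toPreL2.symm x) * P.toPreL2.symm y)
  conj_inner_symm x y := by
    rw [← tr_star, star_mul, star_star]
  re_inner_nonneg x := (Complex.nonneg_iff.1 (P.tr_nonneg _)).1
  add_left x y z := by simp [add_mul]
  smul_left x y r := by simp

instance : SeminormedAddCommGroup P.PreL2 :=
  InnerProductSpace.Core.toSeminormedAddCommGroup (c := P.preL2Core)
instance : InnerProductSpace ℂ P.PreL2 := InnerProductSpace.ofCore P.preL2Core

theorem preL2_inner (x y : P.Elt) : ⟪P.toPreL2 x, P.toPreL2 y⟫_ℂ = P.tr (star x * y) := rfl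

theorem preL2_norm_sq (x : P.Elt) : ‖P.toPreL2 x‖ ^ 2 = (P.tr (star x * x)).re := by
  rw [← P.preL2_inner, ← RCLike.re_eq_complex_re, inner_self_eq_norm_sq]

section traceLemmas

theorem norm_tr_star_mul_le (x y : P.Elt) :
    ‖P.tr (star x * y)‖ ≤ ‖P.toPreL2 x‖ * ‖P.toPreL2 y‖ :=
  norm_inner_le_norm (𝕜 := ℂ) (P.toPreL2 x) (P.toPreL2 y)

theorem preL2_norm_mul_le (b x : P.Elt) :
    ‖P.toPreL2 (b * x)‖ ≤ ‖(b : H →L[ℂ] H)‖ * ‖P.toPreL2 x‖ := by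
  let d : P.Elt := ((‖(b : H →L[ℂ] H)‖ : ℂ) ^ 2) • (1 : P.Elt) - star b * b
  let c : P.Elt := ⟨CFC.sqrt (d : H →L[ℂ] H), P.sqrt_mem d⟩
  have hd : 0 ≤ (d : H →L[ℂ] H) := by
    have h := CStarAlgebra.star_mul_le_algebraMap_norm_sq (a := (b : H →L[ℂ] H))
    have h2 : (d : H →L[ℂ] H) = algebraMap ℝ (H →L[ℂ] H) (‖(b : H →L[ℂ] H)‖ ^ 2)
        - star (b : H →L[ℂ] H) * b := by
      simp only [d, Algebra.algebraMap_eq_smul_one]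
      rw [← Complex.coe_smul (‖(b : H →L[ℂ] H)‖ ^ 2)]
      simp
    rw [h2]
    exact sub_nonneg.2 h
  have hc : star c * c = d := by
    apply Subtype.ext
    have h1 : star (CFC.sqrt (d : H →L[ℂ] H)) = CFC.sqrt (d : H →L[ℂ] H) :=
      (CFC.sqrt_nonneg (d : H →L[ℂ] H)).isSelfAdjoint.star_eq
    change star (CFC.sqrt (d : H →L[ℂ] H)) * CFC.sqrt (d : H →L[ℂ] H) = d
    rw [h1, CFC.sqrt_mul_sqrt_self _ hd]
  have h1 := (Complex.nonneg_iff.1 (P.tr_nonneg (c * x))).1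
  have h2 : star (c * x) * (c * x) =
      ((‖(b : H →L[ℂ] H)‖ : ℂ) ^ 2) • (star x * x) - star (b * x) * (b * x) := by
    calc star (c * x) * (c * x) = star x * (star c * c) * x := by
          simp only [star_mul, mul_assoc]
      _ = _ := by
          rw [hc]
          simp only [d, star_mul, mul_assoc, mul_sub, sub_mul, mul_smul_comm, smul_mul_assoc,
            mul_one]
  rw [h2, map_sub, map_smul, Complex.sub_re, smul_eq_mul, ← Complex.ofReal_pow,
    Complex.re_ofReal_mul, ← preL2_norm_sq, ← preL2_norm_sq, ← mul_pow] at h1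
  exact (sq_le_sq₀ (norm_nonneg _) (by positivity)).1 (by linarith)

theorem preL2_norm_one : ‖P.toPreL2 1‖ = 1 := by
  have := P.preL2_norm_sq 1
  simp only [star_one, mul_one, P.tr_one, Complex.one_re] at this
  nlinarith [norm_nonneg (P.toPreL2 1)]

theorem norm_tr_le (x : P.Elt) : ‖P.tr x‖ ≤ ‖(x : H →L[ℂ] H)‖ := by
  have h1 := P.norm_tr_star_mul_le 1 x
  have h2 := P.preL2_norm_mul_le x 1
  simp only [star_one, one_mul, mul_one, preL2_norm_one] at h1 h2
  exact h1.trans h2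

theorem norm_mul_cfc_modulus_le (x : P.Elt) (f : ℝ → ℝ) (hf : ContinuousOn f (Set.Ici 0))
    {C : ℝ} (hC : 0 ≤ C) (h : ∀ t, 0 ≤ t → |t * f t| ≤ C) :
    ‖(x : H →L[ℂ] H) * cfc f (CFC.abs (x : H →L[ℂ] H))‖ ≤ C ∧
      ‖cfc (fun t => t * f t) (CFC.abs (x : H →L[ℂ] H))‖ ≤ C := by
  have hpos := CFC.abs_nonneg (x : H →L[ℂ] H)
  have hsub : spectrum ℝ (CFC.abs (x : H →L[ℂ] H)) ⊆ Set.Ici 0 :=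
    fun t ht => spectrum_nonneg_of_nonneg hpos ht
  have hf' := hf.mono hsub
  have key : ‖cfc (fun t => t * f t) (CFC.abs (x : H →L[ℂ] H))‖ ≤ C :=
    norm_cfc_le hC fun t ht => h t (hsub ht)
  refine ⟨?_, key⟩
  have hsa : star (cfc f (CFC.abs (x : H →L[ℂ] H))) = cfc f (CFC.abs (x : H →L[ℂ] H)) :=
    (cfc_predicate f _ : IsSelfAdjoint _).star_eq
  have habs : star (CFC.abs (x : H →L[ℂ] H)) = CFC.abs (x : H →L[ℂ] H) :=
    hpos.isSelfAdjoint.star_eq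
  have h1 : cfc (fun t => t * f t) (CFC.abs (x : H →L[ℂ] H)) =
      CFC.abs (x : H →L[ℂ] H) * cfc f (CFC.abs (x : H →L[ℂ] H)) := by
    rw [cfc_mul (fun t => t) f _ continuousOn_id hf', cfc_id' ℝ _ hpos.isSelfAdjoint]
  have h2 : ‖(x : H →L[ℂ] H) * cfc f (CFC.abs (x : H →L[ℂ] H))‖ =
      ‖CFC.abs (x : H →L[ℂ] H) * cfc f (CFC.abs (x : H →L[ℂ] H))‖ := by
    refine (mul_self_inj (norm_nonneg _) (norm_nonneg _)).1 ?_
    rw [← CStarRing.norm_star_mul_self, ← CStarRing.norm_star_mul_self]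
    congr 1
    rw [star_mul, star_mul, hsa, habs]
    simp only [mul_assoc]
    rw [← mul_assoc (star (x : H →L[ℂ] H)), ← CFC.abs_mul_abs, mul_assoc]
  rw [h2, ← h1]
  exact key

theorem exists_approx_polar (x : P.Elt) {ε : ℝ} (hε : 0 < ε) :
    ∃ v : P.Elt, ‖(v : H →L[ℂ] H)‖ ≤ 1 ∧
      ‖((x - v * P.modulus x : P.Elt) : H →L[ℂ] H)‖ ≤ ε ∧
      ‖((P.modulus x - star v * x : P.Elt) : H →L[ℂ] H)‖ ≤ ε := by
  have hpos := CFC.abs_nonneg (x : H →L[ℂ] H)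
  have hsub : spectrum ℝ (CFC.abs (x : H →L[ℂ] H)) ⊆ Set.Ici 0 :=
    fun t ht => spectrum_nonneg_of_nonneg hpos ht
  have hne : ∀ t ∈ Set.Ici (0 : ℝ), t + ε ≠ 0 := fun t ht => by
    have : (0 : ℝ) ≤ t := ht
    positivity
  have hr : ContinuousOn (fun t : ℝ => (t + ε)⁻¹) (Set.Ici 0) :=
    ContinuousOn.inv₀ (by fun_prop) hne
  have hr' := hr.mono hsub
  have hq : ContinuousOn (fun t : ℝ => 1 - (t + ε)⁻¹ * t) (Set.Ici 0) :=
    continuousOn_const.sub (hr.mul continuousOn_id)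
  let r : P.Elt := ⟨cfc (fun t : ℝ => (t + ε)⁻¹) (CFC.abs (x : H →L[ℂ] H)),
    P.cfc_mem (P.modulus x) _⟩
  have hrt : cfc (fun t : ℝ => (t + ε)⁻¹ * t) (CFC.abs (x : H →L[ℂ] H)) =
      cfc (fun t : ℝ => (t + ε)⁻¹) (CFC.abs (x : H →L[ℂ] H)) * CFC.abs (x : H →L[ℂ] H) := by
    rw [cfc_mul (fun t : ℝ => (t + ε)⁻¹) (fun t => t) _ hr' continuousOn_id,
      cfc_id' ℝ _ hpos.isSelfAdjoint]
  have hq1 : cfc (fun t : ℝ => 1 - (t + ε)⁻¹ * t) (CFC.abs (x : H →L[ℂ] H)) =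
      1 - cfc (fun t : ℝ => (t + ε)⁻¹) (CFC.abs (x : H →L[ℂ] H)) * CFC.abs (x : H →L[ℂ] H) := by
    rw [cfc_sub (fun _ : ℝ => (1 : ℝ)) (fun t => (t + ε)⁻¹ * t) _ continuousOn_const
      (hr'.mul continuousOn_id), hrt, cfc_const_one ℝ _ hpos.isSelfAdjoint]
  have hsa : star (cfc (fun t : ℝ => (t + ε)⁻¹) (CFC.abs (x : H →L[ℂ] H))) =
      cfc (fun t : ℝ => (t + ε)⁻¹) (CFC.abs (x : H →L[ℂ] H)) :=
    (cfc_predicate _ _ : IsSelfAdjoint _).star_eq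
  obtain ⟨hA, -⟩ := P.norm_mul_cfc_modulus_le x _ hr zero_le_one fun t ht => by
    rw [abs_of_nonneg (by positivity), ← div_eq_mul_inv, div_le_one (by positivity)]
    linarith
  obtain ⟨hB, hC⟩ := P.norm_mul_cfc_modulus_le x _ hq hε.le fun t ht => by
    have : t * (1 - (t + ε)⁻¹ * t) = ε * (t / (t + ε)) := by
      have := hne t ht
      field_simp
      ring
    rw [this, abs_of_nonneg (by positivity)]
    refine mul_le_of_le_one_right hε.le ?_
    rw [div_le_one (by positivity)]
    linarith
  refine ⟨x * r, hA, ?_, ?_⟩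
  · rw [hq1, mul_sub, mul_one, ← mul_assoc] at hB
    exact hB
  · rw [cfc_mul (fun t : ℝ => t) _ _ continuousOn_id (hq.mono hsub), hq1,
      cfc_id' ℝ _ hpos.isSelfAdjoint, mul_sub, mul_one] at hC
    have hcomm : CFC.abs (x : H →L[ℂ] H) *
        cfc (fun t : ℝ => (t + ε)⁻¹) (CFC.abs (x : H →L[ℂ] H)) =
        cfc (fun t : ℝ => (t + ε)⁻¹) (CFC.abs (x : H →L[ℂ] H)) * CFC.abs (x : H →L[ℂ] H) :=
      ((Commute.refl (CFC.abs (x : H →L[ℂ] H))).cfc_real _).eq.symm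
    have : ((P.modulus x - star (x * r) * x : P.Elt) : H →L[ℂ] H) =
        CFC.abs (x : H →L[ℂ] H) - CFC.abs (x : H →L[ℂ] H) *
        (cfc (fun t : ℝ => (t + ε)⁻¹) (CFC.abs (x : H →L[ℂ] H)) * CFC.abs (x : H →L[ℂ] H)) := by
      change CFC.abs (x : H →L[ℂ] H) - star ((x : H →L[ℂ] H) *
        cfc (fun t : ℝ => (t + ε)⁻¹) (CFC.abs (x : H →L[ℂ] H))) * x = _
      rw [star_mul, hsa, mul_assoc, ← CFC.abs_mul_abs, ← mul_assoc, ← mul_assoc, hcomm]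
    rw [this]
    exact hC

theorem tr_modulus_nonneg (x : P.Elt) : 0 ≤ (P.tr (P.modulus x)).re := by
  let s : P.Elt := ⟨CFC.sqrt (CFC.abs (x : H →L[ℂ] H)), P.sqrt_mem (P.modulus x)⟩
  have hstar : star s = s :=
    Subtype.ext (CFC.sqrt_nonneg (CFC.abs (x : H →L[ℂ] H))).isSelfAdjoint.star_eq
  have hss : star s * s = P.modulus x := by
    rw [hstar]
    exact Subtype.ext (CFC.sqrt_mul_sqrt_self _ (CFC.abs_nonneg _))
  rw [← hss]
  exact (Complex.nonneg_iff.1 (P.tr_nonneg s)).1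

theorem norm_tr_mul_le (b x : P.Elt) :
    ‖P.tr (b * x)‖ ≤ ‖(b : H →L[ℂ] H)‖ * (P.tr (P.modulus x)).re := by
  let s : P.Elt := ⟨CFC.sqrt (CFC.abs (x : H →L[ℂ] H)), P.sqrt_mem (P.modulus x)⟩
  have hpos := CFC.abs_nonneg (x : H →L[ℂ] H)
  have hstar : star s = s :=
    Subtype.ext (CFC.sqrt_nonneg (CFC.abs (x : H →L[ℂ] H))).isSelfAdjoint.star_eq
  have hss : s * s = P.modulus x := Subtype.ext (CFC.sqrt_mul_sqrt_self _ hpos)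
  have hs2 : ‖P.toPreL2 s‖ ^ 2 = (P.tr (P.modulus x)).re := by
    rw [P.preL2_norm_sq, hstar, hss]
  refine le_of_forall_pos_le_add fun δ hδ => ?_
  have hε : 0 < δ / (‖(b : H →L[ℂ] H)‖ + 1) := by positivity
  obtain ⟨v, hv1, hv2, -⟩ := P.exists_approx_polar x hε
  have e1 : b * x = b * v * s * s + b * (x - v * P.modulus x) := by
    rw [← hss]
    noncomm_ring
  have e2 : P.tr (b * v * s * s) = P.tr (star (star (b * v) * s) * s) := by
    rw [P.tr_mul_comm, star_mul, star_star, hstar, mul_assoc s]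
  have e3 : ‖P.tr (b * v * s * s)‖ ≤ ‖(b : H →L[ℂ] H)‖ * (P.tr (P.modulus x)).re := by
    rw [e2, ← hs2]
    refine (P.norm_tr_star_mul_le _ _).trans ?_
    have h1 := P.preL2_norm_mul_le (star (b * v)) s
    have h2 : ‖((star (b * v) : P.Elt) : H →L[ℂ] H)‖ ≤ ‖(b : H →L[ℂ] H)‖ := by
      have h3 : ‖((star (b * v) : P.Elt) : H →L[ℂ] H)‖ = ‖(b : H →L[ℂ] H) * (v : H →L[ℂ] H)‖ :=
        norm_star ((b : H →L[ℂ] H) * (v : H →L[ℂ] H))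
      rw [h3]
      exact (norm_mul_le _ _).trans (mul_le_of_le_one_right (norm_nonneg _) hv1)
    calc ‖P.toPreL2 (star (b * v) * s)‖ * ‖P.toPreL2 s‖
        ≤ (‖(b : H →L[ℂ] H)‖ * ‖P.toPreL2 s‖) * ‖P.toPreL2 s‖ := by
          gcongr
          exact h1.trans (by gcongr)
      _ = _ := by ring
  have e4 : ‖P.tr (b * (x - v * P.modulus x))‖ ≤ δ := by
    refine (P.norm_tr_le _).trans ?_
    calc ‖((b * (x - v * P.modulus x) : P.Elt) : H →L[ℂ] H)‖
        ≤ ‖(b : H →L[ℂ] H)‖ * ‖((x - v * P.modulus x : P.Elt) : H →L[ℂ] H)‖ :=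
          norm_mul_le (b : H →L[ℂ] H) ((x - v * P.modulus x : P.Elt) : H →L[ℂ] H)
      _ ≤ (‖(b : H →L[ℂ] H)‖ + 1) * (δ / (‖(b : H →L[ℂ] H)‖ + 1)) := by
          gcongr
          linarith
      _ = δ := by field_simp
  rw [e1, map_add]
  exact (norm_add_le _ _).trans (add_le_add e3 e4)

theorem exists_tr_modulus_le (x : P.Elt) {ε : ℝ} (hε : 0 < ε) :
    ∃ b : P.Elt, ‖(b : H →L[ℂ] H)‖ ≤ 1 ∧ (P.tr (P.modulus x)).re ≤ (P.tr (b * x)).re + ε := by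
  obtain ⟨v, hv1, -, hv3⟩ := P.exists_approx_polar x hε
  refine ⟨star v, (norm_star (v : H →L[ℂ] H)).le.trans hv1, ?_⟩
  have h1 := (Complex.re_le_norm _).trans ((P.norm_tr_le (P.modulus x - star v * x)).trans hv3)
  rw [map_sub, Complex.sub_re] at h1
  linarith

theorem re_tr_mul_le {b : P.Elt} (hb : ‖(b : H →L[ℂ] H)‖ ≤ 1) (x : P.Elt) :
    (P.tr (b * x)).re ≤ (P.tr (P.modulus x)).re :=
  (Complex.re_le_norm _).trans ((P.norm_tr_mul_le b x).trans
    (mul_le_of_le_one_left (P.tr_modulus_nonneg x) hb))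

theorem norm_tr_le_modulus (x : P.Elt) : ‖P.tr x‖ ≤ (P.tr (P.modulus x)).re := by
  refine (by simpa using P.norm_tr_mul_le 1 x : ‖P.tr x‖ ≤ _).trans ?_
  exact mul_le_of_le_one_left (P.tr_modulus_nonneg x) ContinuousLinearMap.norm_id_le

end traceLemmas

/-- `M` with the `1`-norm `‖x‖₁ = τ(|x|)`. -/
def PreL1 : Type _ := P.Elt

instance : AddCommGroup P.PreL1 := inferInstanceAs (AddCommGroup P.Elt)
instance : Module ℂ P.PreL1 := inferInstanceAs (Module ℂ P.Elt)

/-- The identity map from `M` to `M` with the `1`-norm. -/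
def toPreL1 : P.Elt ≃ₗ[ℂ] P.PreL1 := LinearEquiv.refl ℂ _

instance : Norm P.PreL1 := ⟨fun x => (P.tr (P.modulus (P.toPreL1.symm x))).re⟩

theorem preL1_norm (x : P.Elt) : ‖P.toPreL1 x‖ = (P.tr (P.modulus x)).re := rfl

theorem preL1_core : SeminormedSpace.Core ℂ P.PreL1 where
  norm_nonneg x := P.tr_modulus_nonneg _
  norm_smul c x := by
    have h : P.modulus (c • P.toPreL1.symm x) = (‖c‖ : ℂ) • P.modulus (P.toPreL1.symm x) := by
      apply Subtype.ext
      change CFC.abs (c • ((P.toPreL1.symm x : P.Elt) : H →L[ℂ] H)) =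
        (‖c‖ : ℂ) • CFC.abs ((P.toPreL1.symm x : P.Elt) : H →L[ℂ] H)
      rw [CFC.abs_smul, Complex.coe_smul]
    change (P.tr (P.modulus (c • P.toPreL1.symm x))).re =
      ‖c‖ * (P.tr (P.modulus (P.toPreL1.symm x))).re
    rw [h, map_smul, smul_eq_mul, Complex.re_ofReal_mul]
  norm_triangle x y := by
    change (P.tr (P.modulus (P.toPreL1.symm x + P.toPreL1.symm y))).re ≤
      (P.tr (P.modulus (P.toPreL1.symm x))).re + (P.tr (P.modulus (P.toPreL1.symm y))).re
    refine le_of_forall_pos_le_add fun ε hε => ?_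
    obtain ⟨b, hb, h⟩ := P.exists_tr_modulus_le (P.toPreL1.symm x + P.toPreL1.symm y) hε
    have h1 := P.re_tr_mul_le hb (P.toPreL1.symm x)
    have h2 := P.re_tr_mul_le hb (P.toPreL1.symm y)
    rw [mul_add, map_add, Complex.add_re] at h
    linarith

instance : SeminormedAddCommGroup P.PreL1 := SeminormedAddCommGroup.ofCore P.preL1_core
instance : NormedSpace ℂ P.PreL1 := ⟨fun c x => (P.preL1_core.norm_smul c x).le⟩

theorem preL1_norm_star (x : P.Elt) : ‖P.toPreL1 (star x)‖ = ‖P.toPreL1 x‖ := by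
  have key : ∀ x : P.Elt, ‖P.toPreL1 (star x)‖ ≤ ‖P.toPreL1 x‖ := fun x => by
    rw [preL1_norm, preL1_norm]
    refine le_of_forall_pos_le_add fun ε hε => ?_
    obtain ⟨b, hb, h⟩ := P.exists_tr_modulus_le (star x) hε
    have h1 : (P.tr (b * star x)).re = (P.tr (star b * x)).re := by
      rw [← Complex.conj_re (P.tr (star b * x)), ← tr_star, star_mul, star_star, P.tr_mul_comm]
    have h2 := P.re_tr_mul_le (b := star b) ((norm_star (b : H →L[ℂ] H)).le.trans hb) x
    linarith
  refine le_antisymm (key x) ?_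
  simpa using key (star x)

theorem preL1_norm_le (x : P.Elt) : ‖P.toPreL1 x‖ ≤ ‖P.toPreL2 x‖ := by
  have h1 := (Complex.re_le_norm _).trans (P.norm_tr_star_mul_le 1 (P.modulus x))
  have h2 : ‖P.toPreL2 (P.modulus x)‖ = ‖P.toPreL2 x‖ := by
    refine (sq_eq_sq₀ (norm_nonneg _) (norm_nonneg _)).1 ?_
    rw [preL2_norm_sq, preL2_norm_sq]
    congr 2
    apply Subtype.ext
    change star (CFC.abs (x : H →L[ℂ] H)) * CFC.abs (x : H →L[ℂ] H) = star (x : H →L[ℂ] H) * x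
    rw [(CFC.abs_nonneg (x : H →L[ℂ] H)).isSelfAdjoint.star_eq, CFC.abs_mul_abs]
  rw [star_one, one_mul, preL2_norm_one, one_mul, h2] at h1
  exact h1

/-- `L₁(M)`, the completion of `M` in the `1`-norm; its elements are the random variables. -/
abbrev L1 : Type _ := UniformSpace.Completion P.PreL1

/-- `L₂(M)`, the completion of `M` in the `2`-norm. -/
abbrev L2 : Type _ := UniformSpace.Completion P.PreL2

/-- The canonical map `M → L₁(M)`. -/
def toL1 : P.Elt →ₗ[ℂ] P.L1 :=
  (UniformSpace.Completion.toComplₗᵢ (𝕜 := ℂ) (E := P.PreL1)).toLinearMap ∘ₗ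
    P.toPreL1.toLinearMap

/-- The trace `τ : L₁(M) → ℂ`, the continuous extension of the trace of `M`. -/
def trL1 : P.L1 →L[ℂ] ℂ :=
  ((P.tr ∘ₗ P.toPreL1.symm.toLinearMap).mkContinuous 1 (fun x => by
    rw [one_mul]; exact P.norm_tr_le_modulus (P.toPreL1.symm x))).extend
    UniformSpace.Completion.toComplL

/-- The canonical map `L₂(M) → L₁(M)`, the continuous extension of the identity of `M`. -/
def L2toL1 : P.L2 →L[ℂ] P.L1 :=
  ((P.toL1 ∘ₗ P.toPreL2.symm.toLinearMap).mkContinuous 1 (fun x => by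
    rw [one_mul]
    exact (UniformSpace.Completion.norm_coe _).le.trans (P.preL1_norm_le (P.toPreL2.symm x)))).extend
    UniformSpace.Completion.toComplL

/-- The adjoint `x ↦ x*` of `M`, an isometry for the `1`-norm. -/
def preStar : NormedAddGroupHom P.PreL1 P.PreL1 where
  toFun x := P.toPreL1 (star (P.toPreL1.symm x))
  map_add' x y := by simp
  bound' := ⟨1, fun x => by rw [one_mul]; exact (P.preL1_norm_star (P.toPreL1.symm x)).le⟩

/-- The adjoint on `L₁(M)`, the continuous extension of the adjoint of `M`. -/
instance : StarAddMonoid P.L1 where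
  star x := P.preStar.completion x
  star_involutive x := by
    change P.preStar.completion (P.preStar.completion x) = x
    induction x using UniformSpace.Completion.induction_on with
    | hp => exact isClosed_eq (by fun_prop) continuous_id
    | ih a =>
      rw [NormedAddGroupHom.completion_coe, NormedAddGroupHom.completion_coe]
      exact congrArg _ (star_star (P.toPreL1.symm a))
  star_add x y := map_add _ _ _

section compatibility

theorem toL1_apply (x : P.Elt) : P.toL1 x = (P.toPreL1 x : P.L1) := rfl

theorem star_toL1 (x : P.Elt) : star (P.toL1 x) = P.toL1 (star x) :=
  NormedAddGroupHom.completion_coe _ _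

theorem trL1_toL1 (x : P.Elt) : P.trL1 (P.toL1 x) = P.tr x :=
  ContinuousLinearMap.extend_eq _ (UniformSpace.Completion.denseRange_coe)
    (UniformSpace.Completion.isUniformInducing_coe _) _

theorem L2toL1_coe (x : P.Elt) : P.L2toL1 (P.toPreL2 x : P.L2) = P.toL1 x :=
  ContinuousLinearMap.extend_eq _ (UniformSpace.Completion.denseRange_coe)
    (UniformSpace.Completion.isUniformInducing_coe _) _

theorem L2toL1_injective : Function.Injective P.L2toL1 := by
  have hpair : ∀ (b : P.Elt) (w : P.L2),
      ‖⟪(P.toPreL2 b : P.L2), w⟫_ℂ‖ ≤ ‖(b : H →L[ℂ] H)‖ * ‖P.L2toL1 w‖ := fun b w => by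
    induction w using UniformSpace.Completion.induction_on with
    | hp => exact isClosed_le (by fun_prop) (by fun_prop)
    | ih a =>
      obtain ⟨a, rfl⟩ := P.toPreL2.surjective a
      rw [L2toL1_coe, UniformSpace.Completion.inner_coe, preL2_inner, toL1_apply,
        UniformSpace.Completion.norm_coe, preL1_norm]
      refine (P.norm_tr_mul_le (star b) a).trans_eq ?_
      congr 1
      exact norm_star (b : H →L[ℂ] H)
  rw [injective_iff_map_eq_zero]
  intro w hw
  have h0 : ∀ b : P.PreL2, ⟪(b : P.L2), w⟫_ℂ = 0 := fun b => by
    have := hpair (P.toPreL2.symm b) w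
    rw [hw, norm_zero, mul_zero] at this
    exact norm_le_zero_iff.1 this
  have h1 : ∀ v : P.L2, ⟪v, w⟫_ℂ = 0 := fun v => by
    induction v using UniformSpace.Completion.induction_on with
    | hp => exact isClosed_eq (by fun_prop) continuous_const
    | ih a => exact h0 a
  exact inner_self_eq_zero.1 (h1 w)

end compatibility

/-- `τ(z²) ∈ [0, ∞]` for a self-adjoint `z ∈ L₁(M)`: it is `‖z‖₂²` if `z` is in `L₂(M)` (viewed
in `L₁(M)` through the injective canonical map), and `∞` otherwise. -/
def trSq (z : P.L1) : ℝ≥0∞ := ⨅ (w : P.L2) (_ : P.L2toL1 w = z), ENNReal.ofReal (‖w‖ ^ 2)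

theorem trSq_toL1 (x : P.Elt) (hx : star x = x) :
    P.trSq (P.toL1 x) = ENNReal.ofReal (P.tr (x * x)).re := by
  have h : ‖(P.toPreL2 x : P.L2)‖ ^ 2 = (P.tr (x * x)).re := by
    rw [UniformSpace.Completion.norm_coe, preL2_norm_sq, hx]
  rw [← h]
  refine le_antisymm (iInf₂_le (P.toPreL2 x : P.L2) (P.L2toL1_coe x)) (le_iInf₂ fun w hw => ?_)
  rw [P.L2toL1_injective (hw.trans (P.L2toL1_coe x).symm)]

/-- `var(y) = τ((y - τ(y) 1)²)`. -/
def var (y : P.L1) : ℝ≥0∞ := P.trSq (y - P.trL1 y • P.toL1 1)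

/-- `L₁(N)` for a von Neumann subalgebra `N` of `M`: the closure of `N` in `L₁(M)`. -/
def L1Sub (N : VonNeumannAlgebra H) : Set P.L1 :=
  closure (P.toL1 '' {x : P.Elt | (x : H →L[ℂ] H) ∈ N})

/-- Tensor independence of a finite family of von Neumann subalgebras. -/
def TensorIndependent {n : ℕ} (N : Fin n → VonNeumannAlgebra H) : Prop :=
  ∀ (m : ℕ) (a : Fin n → Fin m → P.Elt), (∀ k i, (a k i : H →L[ℂ] H) ∈ N k) →
    P.tr (List.ofFn fun i => (List.ofFn fun k => a k i).prod).prod =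
      ∏ k, P.tr (List.ofFn fun i => a k i).prod

/-- Free independence of a finite family of von Neumann subalgebras: `τ(a₀ a₁ ⋯ aₘ) = 0` whenever
the `aₖ` are centred and neighbouring factors come from distinct subalgebras. -/
def FreelyIndependent {n : ℕ} (N : Fin n → VonNeumannAlgebra H) : Prop :=
  ∀ (m : ℕ) (i : Fin (m + 1) → Fin n) (a : Fin (m + 1) → P.Elt),
    (∀ k, (a k : H →L[ℂ] H) ∈ N (i k)) → (∀ k : Fin m, i k.castSucc ≠ i k.succ) →
    (∀ k, P.tr (a k) = 0) → P.tr (List.ofFn a).prod = 0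

end NCProbabilitySpace

end

noncomputable section

/-! The proof is a duality argument: `y` is tested against bounded elements `b`, so no conditional
expectation of an unbounded element is needed. Let `E_j` be the trace preserving conditional
expectation onto the algebra generated by the `N k` with `k ≥ j`. The martingale differences `c_j`
of `b` sum to `b - τ(b)1` and are orthogonal in the 2-norm, so `∑ ‖c_j‖₂² ≤ ‖b‖₂²`
(`exists_orthogonal_decomposition`). Independence makes the generated algebras form commuting
squares (`tr_mul_eq_zero_of_inter`), and hence `c_j` is orthogonal to everything generated by the `N
k` with `k ≠ j`. In particular `τ(c_j y_j) = 0`, so that `τ(b (y - τ(y)1)) = τ((b - τ(b)1) y) = ∑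
τ(c_j (y - y_j))`. If the right side of the inequality is finite, Cauchy-Schwarz bounds this by `(∑
‖y - y_j‖₂²)^{1/2} ‖b‖₂` for every `b`. By Riesz, `y - τ(y)1` is then in `L₂` with the required norm
(`exists_L2toL1_eq`).

Two facts about von Neumann algebras carry this. Conditional expectations exist because `M` is the
dual of `L₁(M)` (`exists_tr_mul_eq`), which rests on the closedness of operator norm balls in
`L₂(M)`. Commuting squares are checked on words in the letters of the `N k`, then extended by 2-norm
density of the generated `*`-algebra, which follows from von Neumann's density theorem and
normality. -/

/-! ### Weak limits of bounded sequences, square summable families. -/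

/-- A norm bounded sequence of operators converges weakly along every ultrafilter. -/
theorem exists_weak_limit_of_bounded {H : Type*} [NormedAddCommGroup H] [InnerProductSpace ℂ H]
    [CompleteSpace H] (U : Ultrafilter ℕ) (a : ℕ → H →L[ℂ] H) {C : ℝ} (hC : ∀ k, ‖a k‖ ≤ C) :
    ∃ T : H →L[ℂ] H, ‖T‖ ≤ C ∧
      ∀ ξ η : H, Filter.Tendsto (fun k => ⟪ξ, a k η⟫_ℂ) U (𝓝 ⟪ξ, T η⟫_ℂ) := by
  have hC0 : 0 ≤ C := (norm_nonneg _).trans (hC 0)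
  have hbd : ∀ (ξ η : H) (k : ℕ), ‖⟪a k ξ, η⟫_ℂ‖ ≤ C * ‖ξ‖ * ‖η‖ := fun ξ η k =>
    (norm_inner_le_norm _ _).trans (by gcongr; exact (a k).le_of_opNorm_le (hC k) ξ)
  have hex : ∀ ξ η : H, ∃ c : ℂ, ‖c‖ ≤ C * ‖ξ‖ * ‖η‖ ∧
      Filter.Tendsto (fun k => ⟪a k ξ, η⟫_ℂ) U (𝓝 c) := fun ξ η => by
    obtain ⟨c, hc, hlim⟩ := (isCompact_closedBall (0 : ℂ) (C * ‖ξ‖ * ‖η‖)).ultrafilter_le_nhds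
      (U.map fun k => ⟪a k ξ, η⟫_ℂ) (by
        rw [Filter.le_principal_iff]
        exact (Filter.Eventually.of_forall fun k => by simpa using hbd ξ η k :
          ∀ᶠ k in (U : Filter ℕ), ⟪a k ξ, η⟫_ℂ ∈ Metric.closedBall (0 : ℂ) (C * ‖ξ‖ * ‖η‖)))
    exact ⟨c, by simpa using hc, hlim⟩
  choose L hLn hL using hex
  -- The limits form a bounded sesquilinear form, which is represented by an operator.
  let B : H →L⋆[ℂ] H →L[ℂ] ℂ := LinearMap.mkContinuous₂
    (LinearMap.mk₂'ₛₗ (starRingEnd ℂ) (RingHom.id ℂ) L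
      (fun x y z => tendsto_nhds_unique (hL _ _) (by
        simpa [inner_add_left] using (hL x z).add (hL y z)))
      (fun c x z => tendsto_nhds_unique (hL _ _) (by
        simpa [inner_smul_left, mul_comm] using (hL x z).const_mul (starRingEnd ℂ c)))
      (fun x y z => tendsto_nhds_unique (hL _ _) (by
        simpa [inner_add_right] using (hL x y).add (hL x z)))
      (fun c x z => tendsto_nhds_unique (hL _ _) (by
        simpa [inner_smul_right] using (hL x z).const_mul c))) C hLn
  refine ⟨InnerProductSpace.continuousLinearMapOfBilin B, ?_, fun ξ η => ?_⟩
  · refine ContinuousLinearMap.opNorm_le_bound _ hC0 fun v => ?_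
    rw [InnerProductSpace.continuousLinearMapOfBilin]
    refine (LinearIsometryEquiv.norm_map (InnerProductSpace.toDual ℂ H).symm (B v)).trans_le ?_
    exact ContinuousLinearMap.opNorm_le_bound _ (by positivity) fun w => hLn v w
  · have h : ⟪InnerProductSpace.continuousLinearMapOfBilin B η, ξ⟫_ℂ = L η ξ :=
      InnerProductSpace.continuousLinearMapOfBilin_apply B η ξ
    have h2 := (Complex.continuous_conj.tendsto _).comp (hL η ξ)
    rw [← h, inner_conj_symm] at h2
    simpa only [Function.comp_def, inner_conj_symm] using h2

theorem memlp_two_iff {ι E : Type*} [NormedAddCommGroup E] {ξ : ι → E} : Memℓp ξ 2 ↔ Summable fun i => ‖ξ i‖ ^ 2 := by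
  rw [memℓp_gen_iff (by norm_num)]
  norm_num

theorem lp_two_norm_sq {ι E : Type*} [NormedAddCommGroup E] (f : lp (fun _ : ι => E) 2) : ‖f‖ ^ 2 = ∑' i, ‖f i‖ ^ 2 := by
  have := lp.norm_rpow_eq_tsum (p := 2) (by norm_num) f
  norm_num at this
  exact this

theorem summable_norm_mul_norm {ι E : Type*} [NormedAddCommGroup E] {ξ η : ι → E} 
    (hξ : Summable fun i => ‖ξ i‖ ^ 2) (hη : Summable fun i => ‖η i‖ ^ 2) : Summable fun i => ‖ξ i‖ * ‖η i‖ :=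
  Summable.of_nonneg_of_le (fun _ => by positivity)
    (fun i => by nlinarith [sq_nonneg (‖ξ i‖ - ‖η i‖), sq_nonneg (‖ξ i‖ + ‖η i‖)]) (hξ.add hη)

/-! ### Von Neumann's density theorem on Hilbert sums. -/

section doubleCommutant

variable {H : Type*} [NormedAddCommGroup H] [InnerProductSpace ℂ H] {ι : Type*}

theorem summable_norm_sq_apply (T : H →L[ℂ] H) {ξ : ι → H} (hξ : Summable fun i => ‖ξ i‖ ^ 2) :
    Summable fun i => ‖T (ξ i)‖ ^ 2 := by
  refine Summable.of_nonneg_of_le (fun _ => by positivity) (fun i => ?_) (hξ.mul_left (‖T‖ ^ 2))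
  rw [← mul_pow]
  gcongr
  exact T.le_opNorm _

theorem norm_inner_apply_le (ξ η : ι → H) {T : H →L[ℂ] H} {C : ℝ} (hT : ‖T‖ ≤ C)
    (i : ι) : ‖⟪ξ i, T (η i)⟫_ℂ‖ ≤ C * (‖ξ i‖ * ‖η i‖) := by
  refine (norm_inner_le_norm _ _).trans ?_
  calc ‖ξ i‖ * ‖T (η i)‖ ≤ ‖ξ i‖ * (C * ‖η i‖) := by
        gcongr
        exact T.le_of_opNorm_le hT _
    _ = _ := by ring

theorem summable_inner_apply {ξ η : ι → H} (hξ : Summable fun i => ‖ξ i‖ ^ 2)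
    (hη : Summable fun i => ‖η i‖ ^ 2) (T : H →L[ℂ] H) :
    Summable fun i => ⟪ξ i, T (η i)⟫_ℂ :=
  Summable.of_norm_bounded ((summable_norm_mul_norm hξ hη).mul_left ‖T‖)
    (norm_inner_apply_le ξ η le_rfl)

/-- The amplification of an operator to the Hilbert sum of copies of `H`. -/
def amplification (ι : Type*) (T : H →L[ℂ] H) :
    lp (fun _ : ι => H) 2 →L[ℂ] lp (fun _ : ι => H) 2 :=
  LinearMap.mkContinuous
    { toFun := fun f => ⟨fun i => T (f i), memlp_two_iff.2
        (summable_norm_sq_apply T (memlp_two_iff.1 (lp.memℓp f)))⟩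
      map_add' := fun f g => by ext i; exact map_add T (f i) (g i)
      map_smul' := fun c f => by ext i; exact map_smul T c (f i) } ‖T‖ (fun f => by
        refine (sq_le_sq₀ (norm_nonneg _) (by positivity)).1 ?_
        rw [mul_pow, lp_two_norm_sq, lp_two_norm_sq, ← tsum_mul_left]
        have hf := memlp_two_iff.1 (lp.memℓp f)
        refine Summable.tsum_le_tsum (fun i => ?_) (summable_norm_sq_apply T hf) (hf.mul_left _)
        rw [← mul_pow]
        change ‖T (f i)‖ ^ 2 ≤ _
        gcongr
        exact T.le_opNorm _)

@[simp]
theorem amplification_apply (T : H →L[ℂ] H) (f : lp (fun _ : ι => H) 2) (i : ι) :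
    amplification ι T f i = T (f i) := rfl

theorem amplification_single [DecidableEq ι] (T : H →L[ℂ] H) (i : ι) (v : H) :
    amplification ι T (lp.single 2 i v) = lp.single 2 i (T v) := by
  ext j
  simp only [amplification_apply, lp.single_apply, Pi.single_apply]
  split_ifs <;> simp

variable [CompleteSpace H]

theorem inner_amplification_star (T : H →L[ℂ] H) (f g : lp (fun _ : ι => H) 2) :
    ⟪amplification ι (star T) f, g⟫_ℂ = ⟪f, amplification ι T g⟫_ℂ := by
  rw [lp.inner_eq_tsum, lp.inner_eq_tsum]
  congr 1
  ext i
  simp [ContinuousLinearMap.star_eq_adjoint, ContinuousLinearMap.adjoint_inner_left]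

/-- von Neumann's density theorem: an operator in the double commutant of a unital star
algebra is approximated by the algebra on square summable families of vectors. -/
theorem exists_mem_tsum_norm_sq_sub_lt (A : Subalgebra ℂ (H →L[ℂ] H))
    (hstar : ∀ a ∈ A, star a ∈ A) {T : H →L[ℂ] H}
    (hT : T ∈ Set.centralizer (Set.centralizer (A : Set (H →L[ℂ] H))))
    {ξ : ι → H} (hξ : Summable fun i => ‖ξ i‖ ^ 2) {ε : ℝ} (hε : 0 < ε) :
    ∃ a ∈ A, ∑' i, ‖(T - a) (ξ i)‖ ^ 2 < ε := by
  classical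
  let V := lp (fun _ : ι => H) 2
  let x : V := ⟨ξ, memlp_two_iff.2 hξ⟩
  -- The orbit of `x` under the amplified algebra. Its closure `K` is invariant under a star
  -- algebra, so the projection onto `K` commutes with the amplification of `A`.
  let K₀ : Submodule ℂ V :=
    { carrier := (fun a : H →L[ℂ] H => amplification ι a x) '' A
      zero_mem' := ⟨0, A.zero_mem, by ext i; simp⟩
      add_mem' := by
        rintro _ _ ⟨a, ha, rfl⟩ ⟨b, hb, rfl⟩
        exact ⟨a + b, A.add_mem ha hb, by ext i; simp⟩
      smul_mem' := by
        rintro c _ ⟨a, ha, rfl⟩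
        exact ⟨c • a, A.smul_mem ha c, rfl⟩ }
  let K := K₀.topologicalClosure
  have hKc : IsClosed (K : Set V) := K₀.isClosed_topologicalClosure
  have : CompleteSpace K := hKc.completeSpace_coe
  have hK0 : ∀ a ∈ A, ∀ f ∈ K₀, amplification ι a f ∈ K₀ := by
    rintro a ha _ ⟨b, hb, rfl⟩
    exact ⟨a * b, A.mul_mem ha hb, by ext i; simp⟩
  have hK : ∀ a ∈ A, ∀ f ∈ K, amplification ι a f ∈ K := fun a ha f hf =>
    map_mem_closure (amplification ι a).continuous hf (fun f hf => hK0 a ha f hf)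
  have hKp : ∀ a ∈ A, ∀ f ∈ Kᗮ, amplification ι a f ∈ Kᗮ := fun a ha f hf => by
    rw [Submodule.mem_orthogonal] at hf ⊢
    intro u hu
    rw [← inner_amplification_star]
    exact hf _ (hK _ (hstar a ha) u hu)
  let p := K.starProjection
  have hcomm : ∀ a ∈ A, ∀ f, p (amplification ι a f) = amplification ι a (p f) := fun a ha f => by
    have h1 : f = p f + (f - p f) := by abel
    have h2 : p (amplification ι a (p f)) = amplification ι a (p f) :=
      K.starProjection_eq_self_iff.2 (hK a ha _ (K.starProjection_apply_mem f))
    have h3 : p (amplification ι a (f - p f)) = 0 :=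
      (K.starProjection_apply_eq_zero_iff).2
        (hKp a ha _ (K.sub_starProjection_mem_orthogonal f))
    conv_lhs => rw [h1]
    rw [map_add, map_add, h2, h3, add_zero]
  -- The matrix entries of the projection commute with `A`, hence with `T`. So the amplification of
  -- `T` commutes with the projection and preserves `K`.
  let q : ι → ι → H →L[ℂ] H := fun i j =>
    (lp.evalCLM ℂ (fun _ : ι => H) 2 i) ∘L p ∘L (lp.singleContinuousLinearMap ℂ (fun _ : ι => H) 2 j)
  have hq : ∀ i j v, q i j v = p (lp.single 2 j v) i := fun i j v => rfl
  have hqc : ∀ i j, q i j ∈ Set.centralizer (A : Set (H →L[ℂ] H)) := fun i j a ha => by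
    ext v
    change a (q i j v) = q i j (a v)
    rw [hq, hq, ← amplification_single, hcomm a ha, amplification_apply]
  have hTp : ((amplification ι T).comp p) = p.comp (amplification ι T) := by
    refine lp.ext_continuousLinearMap (by norm_num) fun j => ?_
    ext v i
    have := congrArg (fun S : H →L[ℂ] H => S v) (hT (q i j) (hqc i j))
    change q i j (T v) = T (q i j v) at this
    rw [hq, hq, ← amplification_single] at this
    exact this.symm
  have hx : x ∈ K := K₀.le_topologicalClosure ⟨1, A.one_mem, by ext i; simp⟩
  have hTx : amplification ι T x ∈ K := by
    have h := congrArg (fun S : V →L[ℂ] V => S x) hTp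
    change amplification ι T (p x) = p (amplification ι T x) at h
    rw [show p x = x from K.starProjection_eq_self_iff.2 hx] at h
    rw [h]
    exact K.starProjection_apply_mem _
  obtain ⟨_, ⟨a, ha, rfl⟩, hd⟩ := Metric.mem_closure_iff.1 hTx (Real.sqrt ε) (Real.sqrt_pos.2 hε)
  refine ⟨a, ha, ?_⟩
  rw [dist_eq_norm] at hd
  have h := lp_two_norm_sq (amplification ι T x - amplification ι a x)
  have h2 : ∑' i, ‖(T - a) (ξ i)‖ ^ 2 = ‖amplification ι T x - amplification ι a x‖ ^ 2 := by
    rw [h]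
    rfl
  rw [h2, ← Real.sq_sqrt hε.le]
  gcongr

end doubleCommutant

namespace NCProbabilitySpace

variable {H : Type*} [NormedAddCommGroup H] [InnerProductSpace ℂ H] [CompleteSpace H]
variable (P : NCProbabilitySpace H)

/-! ### Consequences of the normality of the trace. -/

section normality

/-- A normal trace is given by two square summable families of vectors. -/
theorem exists_hasSum_tr : ∃ (ι : Type) (ξ η : ι → H), (Summable fun i => ‖ξ i‖ ^ 2) ∧
    (Summable fun i => ‖η i‖ ^ 2) ∧
    ∀ x : P.Elt, HasSum (fun i => ⟪ξ i, (x : H →L[ℂ] H) (η i)⟫_ℂ) (P.tr x) := by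
  let ω : {p : (ℕ → H) × (ℕ → H) //
      Summable (fun i => ‖p.1 i‖ ^ 2) ∧ Summable (fun i => ‖p.2 i‖ ^ 2)} → P.Elt →ₗ[ℂ] ℂ := fun p =>
    { toFun := fun x => ∑' i, ⟪p.1.1 i, (x : H →L[ℂ] H) (p.1.2 i)⟫_ℂ
      map_add' := fun x y => by
        rw [← (summable_inner_apply p.2.1 p.2.2 x).tsum_add (summable_inner_apply p.2.1 p.2.2 y)]
        simp
      map_smul' := fun c x => by
        simp [tsum_mul_left] }
  -- A functional continuous for the coarsest topology making some functionals continuous lies in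
  -- their span. Sums in the span are merged into one pair of families over a disjoint union of
  -- index types.
  have htr : P.tr ∈ Submodule.span ℂ (Set.range ω) :=
    (LinearMap.mem_span_iff_continuous P.tr).2 P.tr_normal
  refine Submodule.span_induction (p := fun φ _ => ∃ (ι : Type) (ξ η : ι → H),
    (Summable fun i => ‖ξ i‖ ^ 2) ∧ (Summable fun i => ‖η i‖ ^ 2) ∧
    ∀ x : P.Elt, HasSum (fun i => ⟪ξ i, (x : H →L[ℂ] H) (η i)⟫_ℂ) (φ x)) ?_ ?_ ?_ ?_ htr
  · rintro _ ⟨p, rfl⟩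
    exact ⟨ℕ, p.1.1, p.1.2, p.2.1, p.2.2, fun x => (summable_inner_apply p.2.1 p.2.2 x).hasSum⟩
  · exact ⟨ℕ, 0, 0, by simp [summable_zero], by simp [summable_zero],
      fun x => by simp⟩
  · rintro φ ψ - - ⟨ι, ξ, η, h1, h2, h3⟩ ⟨κ, ξ', η', h1', h2', h3'⟩
    exact ⟨ι ⊕ κ, Sum.elim ξ ξ', Sum.elim η η', Summable.sum _ h1 h1', Summable.sum _ h2 h2',
      fun x => HasSum.sum (h3 x) (h3' x)⟩
  · rintro c φ - ⟨ι, ξ, η, h1, h2, h3⟩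
    refine ⟨ι, ξ, fun i => c • η i, h1, ?_, fun x => ?_⟩
    · simpa [norm_smul, mul_pow] using h2.mul_left (‖c‖ ^ 2)
    · simpa [inner_smul_right] using (h3 x).mul_left c

/-- The trace is weakly continuous on bounded sequences. -/
theorem tendsto_tr_of_weak {l : Filter ℕ} {a : ℕ → P.Elt} {b : P.Elt} {C : ℝ}
    (hC : ∀ k, ‖(a k : H →L[ℂ] H)‖ ≤ C)
    (h : ∀ ξ η : H, Filter.Tendsto (fun k => ⟪ξ, (a k : H →L[ℂ] H) η⟫_ℂ) l
      (𝓝 ⟪ξ, (b : H →L[ℂ] H) η⟫_ℂ)) :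
    Filter.Tendsto (fun k => P.tr (a k)) l (𝓝 (P.tr b)) := by
  obtain ⟨ι, ξ, η, hξ, hη, hs⟩ := P.exists_hasSum_tr
  simp_rw [← fun x => (hs x).tsum_eq]
  exact tendsto_tsum_of_dominated_convergence ((summable_norm_mul_norm hξ hη).mul_left C)
    (fun i => h _ _) (Filter.Eventually.of_forall fun k => norm_inner_apply_le ξ η (hC k))

/-- This turns the approximation of the density theorem into 2-norm approximation. Since `τ(z* z) =
∑ ⟪z ξᵢ, z ηᵢ⟫`, the arithmetic-geometric mean inequality gives the bound with `ζ` the two families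
put together. -/
theorem exists_preL2_norm_sq_le_tsum : ∃ (ι : Type) (ζ : ι → H), (Summable fun i => ‖ζ i‖ ^ 2) ∧
    ∀ z : P.Elt, ‖P.toPreL2 z‖ ^ 2 ≤ ∑' i, ‖(z : H →L[ℂ] H) (ζ i)‖ ^ 2 := by
  obtain ⟨ι, ξ, η, hξ, hη, hs⟩ := P.exists_hasSum_tr
  refine ⟨ι ⊕ ι, Sum.elim ξ η, Summable.sum _ hξ hη, fun z => ?_⟩
  have h1 := summable_norm_sq_apply (z : H →L[ℂ] H) hξ
  have h2 := summable_norm_sq_apply (z : H →L[ℂ] H) hη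
  have h3 : HasSum (fun i => ‖(z : H →L[ℂ] H) (Sum.elim ξ η i)‖ ^ 2)
      (∑' i, ‖(z : H →L[ℂ] H) (ξ i)‖ ^ 2 + ∑' i, ‖(z : H →L[ℂ] H) (η i)‖ ^ 2) :=
    HasSum.sum h1.hasSum h2.hasSum
  rw [h3.tsum_eq, ← h1.tsum_add h2, P.preL2_norm_sq]
  refine (Complex.re_le_norm _).trans ?_
  rw [← (hs _).tsum_eq]
  refine tsum_of_norm_bounded (h1.add h2).hasSum fun i => ?_
  have h4 : ⟪ξ i, ((star z * z : P.Elt) : H →L[ℂ] H) (η i)⟫_ℂ =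
      ⟪(z : H →L[ℂ] H) (ξ i), (z : H →L[ℂ] H) (η i)⟫_ℂ := by
    change ⟪ξ i, (star (z : H →L[ℂ] H)) ((z : H →L[ℂ] H) (η i))⟫_ℂ = _
    rw [ContinuousLinearMap.star_eq_adjoint, ContinuousLinearMap.adjoint_inner_right]
  rw [h4]
  refine (norm_inner_le_norm _ _).trans ?_
  nlinarith [sq_nonneg (‖(z : H →L[ℂ] H) (ξ i)‖ - ‖(z : H →L[ℂ] H) (η i)‖),
    sq_nonneg (‖(z : H →L[ℂ] H) (ξ i)‖ + ‖(z : H →L[ℂ] H) (η i)‖)]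

end normality

/-! ### Generated von Neumann algebras and 2-norm density. -/

section generated

theorem generatedVN_le {S : Set (H →L[ℂ] H)} (hS : ∀ s ∈ S, s ∈ P.alg) :
    generatedVN S ≤ P.alg := fun T hT => by
  refine P.mem_of_commute fun g hg => ?_
  refine ((StarSubalgebra.mem_centralizer_iff ℂ).1 hT g ?_).1
  refine (StarSubalgebra.mem_centralizer_iff ℂ).2 fun s hs => ?_
  rw [VonNeumannAlgebra.mem_commutant_iff] at hg
  exact ⟨hg s (hS s hs), hg _ (star_mem (hS s hs))⟩

theorem generatedVN_mono {S T : Set (H →L[ℂ] H)} (h : S ⊆ T) : generatedVN S ≤ generatedVN T :=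
  fun _ hx => (StarSubalgebra.mem_centralizer_iff ℂ).2 fun _ hg =>
    (StarSubalgebra.mem_centralizer_iff ℂ).1 hx _ ((StarSubalgebra.mem_centralizer_iff ℂ).2
      fun s hs => (StarSubalgebra.mem_centralizer_iff ℂ).1 hg s (h hs))

theorem subset_generatedVN (S : Set (H →L[ℂ] H)) {s : H →L[ℂ] H} (hs : s ∈ S) :
    s ∈ generatedVN S := by
  refine (StarSubalgebra.mem_centralizer_iff ℂ).2 fun g hg => ?_
  have h := (StarSubalgebra.mem_centralizer_iff ℂ).1 hg s hs
  refine ⟨h.1.symm, ?_⟩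
  have h2 := congrArg star h.2
  simp only [star_mul, star_star] at h2
  exact h2

/-- The `*`-algebra generated by a self-adjoint set is `2`-norm dense in the von Neumann algebra
generated by it. -/
theorem exists_mem_adjoin_norm_sub_lt {S : Set (H →L[ℂ] H)} (hS : ∀ s ∈ S, s ∈ P.alg)
    (hstar : ∀ s ∈ S, star s ∈ S) {x : P.Elt} (hx : (x : H →L[ℂ] H) ∈ generatedVN S)
    {ε : ℝ} (hε : 0 < ε) :
    ∃ c ∈ Algebra.adjoin ℂ {y : P.Elt | (y : H →L[ℂ] H) ∈ S}, ‖P.toPreL2 (x - c)‖ < ε := by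
  obtain ⟨ι, ζ, hζ, hle⟩ := P.exists_preL2_norm_sq_le_tsum
  have hT : (x : H →L[ℂ] H) ∈ Set.centralizer (Set.centralizer
      (Algebra.adjoin ℂ S : Set (H →L[ℂ] H))) := fun g hg => by
    refine ((StarSubalgebra.mem_centralizer_iff ℂ).1 hx g ?_).1
    refine (StarSubalgebra.mem_centralizer_iff ℂ).2 fun s hs => ⟨?_, ?_⟩
    · exact hg s (Algebra.subset_adjoin hs)
    · exact hg _ (Algebra.subset_adjoin (hstar s hs))
  have hA : ∀ a ∈ Algebra.adjoin ℂ S, star a ∈ Algebra.adjoin ℂ S := fun a ha => by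
    induction ha using Algebra.adjoin_induction with
    | mem s hs => exact Algebra.subset_adjoin (hstar s hs)
    | algebraMap r =>
      rw [Algebra.algebraMap_eq_smul_one, star_smul, star_one]
      exact Subalgebra.smul_mem _ (one_mem _) _
    | add a b _ _ ha hb => rw [star_add]; exact add_mem ha hb
    | mul a b _ _ ha hb => rw [star_mul]; exact mul_mem hb ha
  obtain ⟨a, ha, hlt⟩ := exists_mem_tsum_norm_sq_sub_lt _ hA hT hζ (pow_pos hε 2)
  have hlift : ∃ c ∈ Algebra.adjoin ℂ {y : P.Elt | (y : H →L[ℂ] H) ∈ S}, (c : H →L[ℂ] H) = a := by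
    clear hlt
    induction ha using Algebra.adjoin_induction with
    | mem s hs => exact ⟨⟨s, hS s hs⟩, Algebra.subset_adjoin hs, rfl⟩
    | algebraMap r => exact ⟨algebraMap ℂ _ r, Subalgebra.algebraMap_mem _ r, rfl⟩
    | add a b _ _ ha hb =>
      obtain ⟨c, hc, rfl⟩ := ha
      obtain ⟨d, hd, rfl⟩ := hb
      exact ⟨c + d, add_mem hc hd, rfl⟩
    | mul a b _ _ ha hb =>
      obtain ⟨c, hc, rfl⟩ := ha
      obtain ⟨d, hd, rfl⟩ := hb
      exact ⟨c * d, mul_mem hc hd, rfl⟩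
  obtain ⟨c, hc, rfl⟩ := hlift
  exact ⟨c, hc, lt_of_pow_lt_pow_left₀ 2 hε.le ((hle _).trans_lt hlt)⟩

end generated

/-! ### Duality between `L₁(M)` and `M`, conditional expectations. -/

section conditionalExpectation

/-- Norm bounded subsets of the form `{a | ‖a‖ ≤ C}` are closed in `L₂(M)`. -/
theorem isClosed_ball_L2 (C : ℝ) :
    IsClosed {w : P.L2 | ∃ a : P.Elt, ‖(a : H →L[ℂ] H)‖ ≤ C ∧ (P.toPreL2 a : P.L2) = w} := by
  refine isClosed_of_closure_subset fun w hw => ?_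
  obtain ⟨u, hu, hlim⟩ := mem_closure_iff_seq_limit.1 hw
  choose a haC hau using hu
  let U : Ultrafilter ℕ := Filter.hyperfilter ℕ
  obtain ⟨T, hTC, hT⟩ := exists_weak_limit_of_bounded U (fun k => (a k : H →L[ℂ] H)) haC
  have hTmem : T ∈ P.alg.toStarSubalgebra := P.mem_of_commute fun g hg => by
    refine ContinuousLinearMap.ext fun η => ext_inner_left ℂ fun ξ => ?_
    have h1 := hT ((star g) ξ) η
    have h2 := hT ξ (g η)
    have e : ∀ S : H →L[ℂ] H, ⟪(star g) ξ, S η⟫_ℂ = ⟪ξ, (g * S) η⟫_ℂ := fun S => by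
      rw [ContinuousLinearMap.star_eq_adjoint, ContinuousLinearMap.adjoint_inner_left]
      rfl
    simp_rw [e] at h1
    simp_rw [(P.commute_of_mem _ hg).eq] at h1
    exact tendsto_nhds_unique h1 h2
  refine ⟨⟨T, hTmem⟩, hTC, ?_⟩
  -- By normality `τ(m* a k)` tends to `τ(m* T)` along `U`, while 2-norm convergence makes it tend
  -- to `⟪m, w⟫`; hence `T` and `w` agree against the dense subspace `M`.
  have key : ∀ m : P.Elt, ⟪(P.toPreL2 m : P.L2), (P.toPreL2 (⟨T, hTmem⟩ : P.Elt) : P.L2)⟫_ℂ =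
      ⟪(P.toPreL2 m : P.L2), w⟫_ℂ := fun m => by
    have h1 : Filter.Tendsto (fun k => ⟪(P.toPreL2 m : P.L2), u k⟫_ℂ) U
        (𝓝 ⟪(P.toPreL2 m : P.L2), w⟫_ℂ) :=
      (tendsto_const_nhds.inner hlim).mono_left (Nat.hyperfilter_le_atTop)
    refine tendsto_nhds_unique ?_ h1
    simp_rw [← hau, UniformSpace.Completion.inner_coe, preL2_inner]
    refine P.tendsto_tr_of_weak (C := ‖(m : H →L[ℂ] H)‖ * C) (fun k => ?_) fun ξ η => ?_
    · refine (norm_mul_le (star (m : H →L[ℂ] H)) (a k : H →L[ℂ] H)).trans ?_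
      rw [norm_star]
      gcongr
      exact haC k
    · have e : ∀ S : P.Elt, ⟪ξ, ((star m * S : P.Elt) : H →L[ℂ] H) η⟫_ℂ =
          ⟪(m : H →L[ℂ] H) ξ, (S : H →L[ℂ] H) η⟫_ℂ := fun S => by
        change ⟪ξ, (star (m : H →L[ℂ] H)) ((S : H →L[ℂ] H) η)⟫_ℂ = _
        rw [ContinuousLinearMap.star_eq_adjoint, ContinuousLinearMap.adjoint_inner_right]
      simp_rw [e]
      exact hT _ _
  refine ext_inner_left ℂ fun v => ?_
  induction v using UniformSpace.Completion.induction_on with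
  | hp => exact isClosed_eq (by fun_prop) (by fun_prop)
  | ih v => exact key (P.toPreL2.symm v)

/-- A linear functional on `M` that is bounded for the `2`-norm is the inner product with a vector
of `L₂(M)`. -/
theorem exists_inner_eq (φ : P.Elt →ₗ[ℂ] ℂ) {C : ℝ} (hC : 0 ≤ C)
    (h : ∀ x, ‖φ x‖ ≤ C * ‖P.toPreL2 x‖) :
    ∃ v : P.L2, ‖v‖ ≤ C ∧ ∀ x, ⟪v, (P.toPreL2 x : P.L2)⟫_ℂ = φ x := by
  let F : P.PreL2 →L[ℂ] ℂ := (φ ∘ₗ P.toPreL2.symm.toLinearMap).mkContinuous C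
    fun x => h (P.toPreL2.symm x)
  let G : P.L2 →L[ℂ] ℂ := F.extend UniformSpace.Completion.toComplL
  have hG : ∀ x : P.Elt, G (P.toPreL2 x : P.L2) = φ x := fun x =>
    ContinuousLinearMap.extend_eq F UniformSpace.Completion.denseRange_coe
      (UniformSpace.Completion.isUniformInducing_coe _) _
  refine ⟨(InnerProductSpace.toDual ℂ P.L2).symm G, ?_, fun x => ?_⟩
  · rw [LinearIsometryEquiv.norm_map]
    refine ContinuousLinearMap.opNorm_le_bound _ hC fun v => ?_
    induction v using UniformSpace.Completion.induction_on with
    | hp => exact isClosed_le (by fun_prop) (by fun_prop)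
    | ih v =>
      rw [UniformSpace.Completion.norm_coe]
      exact (congrArg norm (hG (P.toPreL2.symm v))).trans_le (h _)
  · rw [InnerProductSpace.toDual_symm_apply, hG]

/-- The dual of `L₁(M)` is `M`. -/
theorem exists_tr_mul_eq (φ : P.Elt →ₗ[ℂ] ℂ) {C : ℝ} (hC : 0 ≤ C)
    (h : ∀ x, ‖φ x‖ ≤ C * (P.tr (P.modulus x)).re) : ∃ a : P.Elt, ∀ x, φ x = P.tr (a * x) := by
  obtain ⟨p, -, hp⟩ := P.exists_inner_eq φ hC fun x =>
    (h x).trans (mul_le_mul_of_nonneg_left (P.preL1_norm_le x) hC)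
  -- The Riesz vector `p` has to be shown to come from an operator of norm at most `C`. Otherwise
  -- Hahn-Banach separates it from the closed convex set `K`.
  let K : Set P.L2 := {w | ∃ a : P.Elt, ‖(a : H →L[ℂ] H)‖ ≤ C ∧ (P.toPreL2 a : P.L2) = w}
  have hKconv : Convex ℝ K := by
    rintro _ ⟨a, ha, rfl⟩ _ ⟨b, hb, rfl⟩ s t hs ht hst
    refine ⟨(s : ℂ) • a + (t : ℂ) • b, ?_, ?_⟩
    · calc ‖(s : ℂ) • (a : H →L[ℂ] H) + (t : ℂ) • (b : H →L[ℂ] H)‖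
          ≤ ‖(s : ℂ) • (a : H →L[ℂ] H)‖ + ‖(t : ℂ) • (b : H →L[ℂ] H)‖ := norm_add_le _ _
        _ = s * ‖(a : H →L[ℂ] H)‖ + t * ‖(b : H →L[ℂ] H)‖ := by
          rw [norm_smul, norm_smul, Complex.norm_of_nonneg hs, Complex.norm_of_nonneg ht]
        _ ≤ s * C + t * C := by gcongr
        _ = C := by rw [← add_mul, hst, one_mul]
    · rw [map_add, map_smul, map_smul, UniformSpace.Completion.coe_add,
        UniformSpace.Completion.coe_smul, UniformSpace.Completion.coe_smul, Complex.coe_smul,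
        Complex.coe_smul]
  by_cases hpK : p ∈ K
  · obtain ⟨a, -, rfl⟩ := hpK
    refine ⟨star a, fun x => ?_⟩
    rw [← hp, UniformSpace.Completion.inner_coe, preL2_inner]
  exfalso
  obtain ⟨f, u, hfK, hfp⟩ :=
    RCLike.geometric_hahn_banach_closed_point (𝕜 := ℂ) hKconv (P.isClosed_ball_L2 C) hpK
  let v := (InnerProductSpace.toDual ℂ P.L2).symm f
  have hv : ∀ w, f w = ⟪v, w⟫_ℂ := fun w => (InnerProductSpace.toDual_symm_apply).symm
  -- `R` bounds the 2-norms of `p` and of the element of `K` used below, so replacing the separating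
  -- vector `v` by `n ∈ M` costs at most `δ / 4` at each.
  let R : ℝ := C + ‖p‖ + 1
  have hR : 0 < R := by positivity
  let δ : ℝ := RCLike.re (f p) - u
  have hδ : 0 < δ := sub_pos.2 hfp
  obtain ⟨m, hm⟩ := Metric.denseRange_iff.1 (UniformSpace.Completion.denseRange_coe (α := P.PreL2))
    v (δ / (4 * R)) (by positivity)
  obtain ⟨n, rfl⟩ := P.toPreL2.surjective m
  rw [dist_eq_norm] at hm
  have happrox : ∀ w : P.L2, ‖w‖ ≤ R →
      |(⟪v, w⟫_ℂ).re - (⟪(P.toPreL2 n : P.L2), w⟫_ℂ).re| ≤ δ / 4 := fun w hw => by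
    rw [← Complex.sub_re, ← inner_sub_left]
    refine (Complex.abs_re_le_norm _).trans ((norm_inner_le_norm _ _).trans ?_)
    calc ‖v - (P.toPreL2 n : P.L2)‖ * ‖w‖ ≤ δ / (4 * R) * R := by gcongr
      _ = δ / 4 := by field_simp
  -- On `K` the functional of `n` nearly reaches `C ‖n‖₁`, at `C b`, and its value at `p` is at most
  -- `C ‖n‖₁`. Three errors of `δ / 4` cannot fill the separation gap `δ`.
  obtain ⟨b, hb1, hb⟩ := P.exists_tr_modulus_le (star n) (ε := δ / (4 * R)) (by positivity)
  have hmod : (P.tr (P.modulus (star n))).re = (P.tr (P.modulus n)).re := P.preL1_norm_star n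
  have hCb : ‖(((C : ℂ) • b : P.Elt) : H →L[ℂ] H)‖ ≤ C := by
    change ‖(C : ℂ) • (b : H →L[ℂ] H)‖ ≤ C
    rw [norm_smul, Complex.norm_of_nonneg hC]
    exact mul_le_of_le_one_right hC hb1
  have h1 := hfK _ ⟨(C : ℂ) • b, hCb, rfl⟩
  have hCb2 : ‖(P.toPreL2 ((C : ℂ) • b) : P.L2)‖ ≤ R := by
    rw [UniformSpace.Completion.norm_coe]
    have h2 := P.preL2_norm_mul_le ((C : ℂ) • b) 1
    rw [mul_one, preL2_norm_one, mul_one] at h2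
    have := norm_nonneg p
    linarith
  have h2 := happrox _ hCb2
  have h3 := happrox p (by have := norm_nonneg p; linarith)
  have h4 : (⟪(P.toPreL2 n : P.L2), (P.toPreL2 ((C : ℂ) • b) : P.L2)⟫_ℂ).re =
      C * (P.tr (b * star n)).re := by
    rw [UniformSpace.Completion.inner_coe, preL2_inner, mul_smul_comm, map_smul, smul_eq_mul,
      Complex.re_ofReal_mul, P.tr_mul_comm]
  have h5 : (⟪(P.toPreL2 n : P.L2), p⟫_ℂ).re ≤ C * (P.tr (P.modulus n)).re := by
    rw [← inner_conj_symm, hp, Complex.conj_re]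
    exact (Complex.re_le_norm _).trans (h n)
  rw [hv, RCLike.re_eq_complex_re] at h1
  have hδ' : δ = (⟪v, p⟫_ℂ).re - u := by
    rw [← hv]
    rfl
  rw [h4] at h2
  rw [hmod] at hb
  have h6 : C * (P.tr (P.modulus n)).re ≤ C * (P.tr (b * star n)).re + δ / 4 := by
    have h7 : C * (δ / (4 * R)) ≤ δ / 4 := by
      calc C * (δ / (4 * R)) ≤ R * (δ / (4 * R)) := by
            gcongr
            have := norm_nonneg p
            linarith
        _ = δ / 4 := by field_simp
    nlinarith [mul_le_mul_of_nonneg_left hb hC]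
  rw [abs_le] at h2 h3
  linarith [h2.1, h2.2, h3.1, h3.2]

/-- The inclusion of a von Neumann subalgebra. -/
def incl {N : VonNeumannAlgebra H} (hN : N ≤ P.alg) : N.toStarSubalgebra →ₗ[ℂ] P.Elt where
  toFun x := ⟨x, hN x.2⟩
  map_add' _ _ := rfl
  map_smul' _ _ := rfl

theorem continuous_incl {N : VonNeumannAlgebra H} (hN : N ≤ P.alg) :
    Continuous[ultraweakTopology N, ultraweakTopology P.alg] (P.incl hN) := by
  refine continuous_iInf_rng.2 fun p => continuous_induced_rng.2 ?_
  exact continuous_iInf_dom (i := p) continuous_induced_dom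

/-- A von Neumann subalgebra with the restricted trace. -/
def restrict {N : VonNeumannAlgebra H} (hN : N ≤ P.alg) : NCProbabilitySpace H where
  alg := N
  tr := P.tr ∘ₗ P.incl hN
  tr_nonneg x := P.tr_nonneg (P.incl hN x)
  tr_faithful x hx := Subtype.ext (congrArg (fun y : P.Elt => (y : H →L[ℂ] H))
    (P.tr_faithful (P.incl hN x) hx))
  tr_mul_comm x y := P.tr_mul_comm (P.incl hN x) (P.incl hN y)
  tr_one := P.tr_one
  tr_normal :=
    @Continuous.comp _ _ _ (ultraweakTopology N) (ultraweakTopology P.alg) _ _ _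
      P.tr_normal (P.continuous_incl hN)

/-- Existence of the trace preserving conditional expectation. -/
theorem exists_condExp {N : VonNeumannAlgebra H} (hN : N ≤ P.alg) (x : P.Elt) :
    ∃ a : P.Elt, (a : H →L[ℂ] H) ∈ N ∧
      ∀ m : P.Elt, (m : H →L[ℂ] H) ∈ N → P.tr ((x - a) * m) = 0 := by
  -- The modulus is formed in `B(H)`, so the 1-norm of `P.restrict hN` is the restriction of that of
  -- `P`, and `m ↦ τ(x m)` is bounded for it by `‖x‖`.
  let φ : (P.restrict hN).Elt →ₗ[ℂ] ℂ := P.tr ∘ₗ LinearMap.mulLeft ℂ x ∘ₗ P.incl hN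
  obtain ⟨a, ha⟩ := (P.restrict hN).exists_tr_mul_eq φ (norm_nonneg (x : H →L[ℂ] H))
    fun m => P.norm_tr_mul_le x (P.incl hN m)
  refine ⟨P.incl hN a, a.2, fun m hm => ?_⟩
  have h : P.tr (x * m) = P.tr (P.incl hN a * m) := ha ⟨m, hm⟩
  rw [sub_mul, map_sub, h, sub_self]

end conditionalExpectation

end NCProbabilitySpace

/-! ### Words in the subalgebras, free independence. -/

namespace NCProbabilitySpace

variable {H : Type*} [NormedAddCommGroup H] [InnerProductSpace ℂ H] [CompleteSpace H]
variable (P : NCProbabilitySpace H) {n : ℕ} (N : Fin n → VonNeumannAlgebra H)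

/-- The algebra generated by the subalgebras with index in `I`. -/
def familyAlgebra (I : Set (Fin n)) : Subalgebra ℂ P.Elt :=
  Algebra.adjoin ℂ {y : P.Elt | (y : H →L[ℂ] H) ∈ ⋃ k ∈ I, (N k : Set (H →L[ℂ] H))}

variable {P N}

theorem mem_familyAlgebra_of_mem {I : Set (Fin n)} {k : Fin n} (hk : k ∈ I) {a : P.Elt}
    (ha : (a : H →L[ℂ] H) ∈ N k) : a ∈ P.familyAlgebra N I :=
  Algebra.subset_adjoin (Set.mem_biUnion hk ha)

theorem star_mem_familyAlgebra {I : Set (Fin n)} {a : P.Elt} (ha : a ∈ P.familyAlgebra N I) :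
    star a ∈ P.familyAlgebra N I := by
  induction ha using Algebra.adjoin_induction with
  | mem s hs =>
    obtain ⟨k, hk, hs⟩ := Set.mem_iUnion₂.1 hs
    exact mem_familyAlgebra_of_mem hk (star_mem (S := VonNeumannAlgebra H) hs)
  | algebraMap r =>
    rw [Algebra.algebraMap_eq_smul_one, star_smul, star_one]
    exact Subalgebra.smul_mem _ (one_mem _) _
  | add a b _ _ ha hb => rw [star_add]; exact add_mem ha hb
  | mul a b _ _ ha hb => rw [star_mul]; exact mul_mem hb ha

variable (P N)

/-- The product of the letters of a word. -/
def wordProd (w : List (Fin n × P.Elt)) : P.Elt := (w.map Prod.snd).prod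

/-- A word with letters in the subalgebras with index in `I`. -/
def IsWord (I : Set (Fin n)) (w : List (Fin n × P.Elt)) : Prop :=
  ∀ p ∈ w, p.1 ∈ I ∧ (p.2 : H →L[ℂ] H) ∈ N p.1

/-- A word of centred letters whose neighbours come from distinct subalgebras. -/
def IsReducedWord (w : List (Fin n × P.Elt)) : Prop :=
  w.IsChain (fun p q => p.1 ≠ q.1) ∧ ∀ p ∈ w, P.tr p.2 = 0

variable {P N}

@[simp]
theorem wordProd_nil : P.wordProd ([] : List (Fin n × P.Elt)) = 1 := rfl

@[simp]
theorem wordProd_cons (p : Fin n × P.Elt) (w : List (Fin n × P.Elt)) :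
    P.wordProd (p :: w) = p.2 * P.wordProd w := by
  simp [wordProd]

@[simp]
theorem wordProd_append (w v : List (Fin n × P.Elt)) :
    P.wordProd (w ++ v) = P.wordProd w * P.wordProd v := by
  simp [wordProd]

theorem IsWord.append {I : Set (Fin n)} {w v : List (Fin n × P.Elt)} (hw : P.IsWord N I w)
    (hv : P.IsWord N I v) : P.IsWord N I (w ++ v) := fun p hp =>
  (List.mem_append.1 hp).elim (hw p) (hv p)

theorem IsWord.mono {I J : Set (Fin n)} (h : I ⊆ J) {w : List (Fin n × P.Elt)}
    (hw : P.IsWord N I w) : P.IsWord N J w := fun p hp => ⟨h (hw p hp).1, (hw p hp).2⟩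

theorem isWord_cons {I : Set (Fin n)} {p : Fin n × P.Elt} {w : List (Fin n × P.Elt)} :
    P.IsWord N I (p :: w) ↔ (p.1 ∈ I ∧ (p.2 : H →L[ℂ] H) ∈ N p.1) ∧ P.IsWord N I w := by
  simp [IsWord]

theorem IsWord.wordProd_mem {I : Set (Fin n)} {w : List (Fin n × P.Elt)} (hw : P.IsWord N I w) :
    P.wordProd w ∈ P.familyAlgebra N I := by
  refine list_prod_mem fun x hx => ?_
  obtain ⟨p, hp, rfl⟩ := List.mem_map.1 hx
  exact mem_familyAlgebra_of_mem (hw p hp).1 (hw p hp).2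

/-- If left multiplication by letters preserves the span of a set of words then the span contains
the generated algebra. -/
theorem mem_span_of_mem_familyAlgebra {I : Set (Fin n)} {V : Submodule ℂ P.Elt} (h1 : 1 ∈ V)
    (hV : ∀ k ∈ I, ∀ a : P.Elt, (a : H →L[ℂ] H) ∈ N k → ∀ v ∈ V, a * v ∈ V) {c : P.Elt}
    (hc : c ∈ P.familyAlgebra N I) : c ∈ V := by
  have key : ∀ v ∈ V, c * v ∈ V := by
    induction hc using Algebra.adjoin_induction with
    | mem s hs =>
      obtain ⟨k, hk, hs⟩ := Set.mem_iUnion₂.1 hs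
      exact hV k hk s hs
    | algebraMap r =>
      intro v hv
      rw [Algebra.algebraMap_eq_smul_one, smul_mul_assoc, one_mul]
      exact V.smul_mem r hv
    | add a b _ _ ha hb =>
      intro v hv
      rw [add_mul]
      exact V.add_mem (ha v hv) (hb v hv)
    | mul a b _ _ ha hb =>
      intro v hv
      rw [mul_assoc]
      exact ha _ (hb v hv)
  simpa using key 1 h1

theorem mem_span_words {I : Set (Fin n)} {c : P.Elt} (hc : c ∈ P.familyAlgebra N I) :
    c ∈ Submodule.span ℂ (P.wordProd '' {w | P.IsWord N I w}) := by
  refine mem_span_of_mem_familyAlgebra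
    (Submodule.subset_span (Set.mem_image_of_mem _ (x := []) (by simp [IsWord])))
    (fun k hk a ha v hv => ?_) hc
  induction hv using Submodule.span_induction with
  | mem _ h =>
    obtain ⟨w, hw, rfl⟩ := h
    exact Submodule.subset_span ⟨(k, a) :: w, isWord_cons.2 ⟨⟨hk, ha⟩, hw⟩, by simp⟩
  | zero => simp
  | add x y _ _ hx hy => rw [mul_add]; exact add_mem hx hy
  | smul c x _ hx => rw [mul_smul_comm]; exact Submodule.smul_mem _ _ hx

section center

theorem tr_sub_smul_one (a : P.Elt) : P.tr (a - P.tr a • 1) = 0 := by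
  rw [map_sub, map_smul, P.tr_one, smul_eq_mul, mul_one, sub_self]

theorem sub_smul_one_mem {N : VonNeumannAlgebra H} {a : P.Elt} (ha : (a : H →L[ℂ] H) ∈ N) (c : ℂ) :
    ((a - c • 1 : P.Elt) : H →L[ℂ] H) ∈ N :=
  show (a : H →L[ℂ] H) - c • 1 ∈ N.toStarSubalgebra from
    sub_mem ha (N.toStarSubalgebra.smul_mem (one_mem _) c)

end center

/-- A letter multiplied from the left is split into its centred part and a scalar. If its index
equals that of the first letter, the two are multiplied beforehand and the product is split in front
of the remaining word. -/
theorem mem_span_reducedWords {I : Set (Fin n)} {c : P.Elt} (hc : c ∈ P.familyAlgebra N I) :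
    c ∈ Submodule.span ℂ (P.wordProd '' {w | P.IsWord N I w ∧ P.IsReducedWord w}) := by
  set V := Submodule.span ℂ (P.wordProd '' {w | P.IsWord N I w ∧ P.IsReducedWord w})
  have hword : ∀ w, P.IsWord N I w → P.IsReducedWord w → P.wordProd w ∈ V := fun w h h' =>
    Submodule.subset_span ⟨w, ⟨h, h'⟩, rfl⟩
  refine mem_span_of_mem_familyAlgebra (hword [] (by simp [IsWord]) (by simp [IsReducedWord]))
    (fun k hk a ha v hv => ?_) hc
  induction hv using Submodule.span_induction with
  | mem _ h =>
    obtain ⟨w, ⟨hw, hr⟩, rfl⟩ := h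
    have hcent : ∀ x : P.Elt, (x : H →L[ℂ] H) ∈ N k → ∀ v, P.IsWord N I v → P.IsReducedWord v →
        (∀ q ∈ v.head?, k ≠ q.1) → x * P.wordProd v ∈ V := fun x hx v hv hvr hh => by
      have e : x * P.wordProd v =
          P.wordProd ((k, x - P.tr x • 1) :: v) + P.tr x • P.wordProd v := by
        simp [sub_mul]
      rw [e]
      refine add_mem (hword _ (isWord_cons.2 ⟨⟨hk, sub_smul_one_mem hx _⟩, hv⟩)
        ⟨List.isChain_cons.2 ⟨hh, hvr.1⟩, ?_⟩) (V.smul_mem _ (hword v hv hvr))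
      rintro p hp
      rcases List.mem_cons.1 hp with rfl | hp
      · exact tr_sub_smul_one x
      · exact hvr.2 p hp
    match w, hw, hr with
    | [], hw, hr => exact hcent a ha [] hw hr (by simp)
    | p :: v, hw, hr =>
      obtain ⟨hp, hv⟩ := isWord_cons.1 hw
      obtain ⟨hh, hvc⟩ := List.isChain_cons.1 hr.1
      have hvr : P.IsReducedWord v := ⟨hvc, fun q hq => hr.2 q (List.mem_cons_of_mem _ hq)⟩
      by_cases hkp : k = p.1
      · have e : a * P.wordProd (p :: v) = (a * p.2) * P.wordProd v := by simp [mul_assoc]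
        rw [e]
        subst hkp
        exact hcent _ (mul_mem (S := VonNeumannAlgebra H) ha hp.2) v hv hvr hh
      · exact hcent a ha (p :: v) hw hr (by simpa using hkp)
  | zero => simp
  | add x y _ _ hx hy => rw [mul_add]; exact add_mem hx hy
  | smul c x _ hx => rw [mul_smul_comm]; exact Submodule.smul_mem _ _ hx

theorem FreelyIndependent.tr_wordProd (h : P.FreelyIndependent N) {w : List (Fin n × P.Elt)}
    (hw : P.IsWord N Set.univ w) (hr : P.IsReducedWord w) (hne : w ≠ []) :
    P.tr (P.wordProd w) = 0 := by
  obtain ⟨p, v, rfl⟩ := List.exists_cons_of_ne_nil hne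
  -- `FreelyIndependent` speaks of `m + 1` letters, so `m` is the length of the tail.
  have h1 := h v.length (fun k => ((p :: v).get k).1) (fun k => ((p :: v).get k).2)
    (fun k => (hw _ (List.get_mem _ _)).2)
    (fun k => by
      have := List.isChain_iff_getElem.1 hr.1 k (by simp)
      simpa using this)
    (fun k => hr.2 _ (List.get_mem _ _))
  have e : (List.ofFn fun k => ((p :: v).get k).2) = (p :: v).map Prod.snd := by
    conv_rhs => rw [← List.ofFn_get (p :: v), List.map_ofFn]
    rfl
  rw [← h1]
  exact congrArg (fun l : List P.Elt => P.tr l.prod) e.symm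

/-- In a free family, a reduced word with a letter outside `J` is orthogonal to the reduced words
with letters in `J`. -/
theorem FreelyIndependent.tr_wordProd_mul (h : P.FreelyIndependent N) {J : Set (Fin n)} :
    ∀ (v u : List (Fin n × P.Elt)), P.IsWord N J v → P.IsReducedWord v →
      P.IsWord N Set.univ u → P.IsReducedWord u → (∃ p ∈ u, p.1 ∉ J) →
      P.tr (P.wordProd u * P.wordProd v) = 0
  | [], u, _, _, hu, hur, ⟨p, hp, _⟩ => by
    simpa using h.tr_wordProd hu hur (List.ne_nil_of_mem hp)
  | b :: v, u, hv, hvr, hu, hur, ⟨p, hp, hpJ⟩ => by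
    obtain ⟨u, a, rfl⟩ := List.eq_nil_or_concat' u |>.resolve_left (List.ne_nil_of_mem hp)
    obtain ⟨hb, hv'⟩ := isWord_cons.1 hv
    obtain ⟨hbv, hvc⟩ := List.isChain_cons.1 hvr.1
    obtain ⟨huc, -, hua⟩ := List.isChain_append.1 hur.1
    have hvr' : P.IsReducedWord v := ⟨hvc, fun q hq => hvr.2 q (List.mem_cons_of_mem _ hq)⟩
    have hu' : P.IsWord N Set.univ u := fun q hq => hu q (List.mem_append_left _ hq)
    have hur' : P.IsReducedWord u := ⟨huc, fun q hq => hur.2 q (List.mem_append_left _ hq)⟩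
    have haN := (hu a (by simp)).2
    -- If the adjacent letters `a` and `b` have the same index, that index is in `J`, so the letter
    -- outside `J` survives in the shortened `u`. The centred part of `a b` gives a reduced word and
    -- the scalar part is the induction hypothesis. Otherwise the concatenation is already reduced.
    by_cases hab : a.1 = b.1
    · have hpu : p ∈ u := by
        rcases List.mem_append.1 hp with hp | hp
        · exact hp
        · rw [List.mem_singleton.1 hp, hab] at hpJ
          exact absurd hb.1 hpJ
      have ih := h.tr_wordProd_mul v u hv' hvr' hu' hur' ⟨p, hpu, hpJ⟩
      let c : P.Elt := a.2 * b.2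
      have hc : (c : H →L[ℂ] H) ∈ N a.1 :=
        mul_mem (S := VonNeumannAlgebra H) haN (hab ▸ hb.2)
      have e : P.wordProd (u ++ [a]) * P.wordProd (b :: v) =
          P.wordProd (u ++ (a.1, c - P.tr c • 1) :: v) +
            P.tr c • (P.wordProd u * P.wordProd v) := by
        simp [sub_mul, mul_sub, mul_assoc, c]
      rw [e, map_add, map_smul, ih, smul_zero, add_zero]
      refine h.tr_wordProd (hu'.append (isWord_cons.2
        ⟨⟨trivial, sub_smul_one_mem hc _⟩, hv'.mono (Set.subset_univ _)⟩)) ⟨?_, ?_⟩ (by simp)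
      · refine List.isChain_append.2 ⟨huc, List.isChain_cons.2 ⟨?_, hvc⟩, ?_⟩
        · intro q hq
          rw [hab]
          exact hbv q hq
        · intro q hq r hr
          have hr' : (a.1, c - P.tr c • 1) = r := by simpa using hr
          rw [← hr']
          exact hua q hq a (by simp)
      · intro q hq
        rcases List.mem_append.1 hq with hq | hq
        · exact hur'.2 q hq
        · rcases List.mem_cons.1 hq with rfl | hq
          · exact tr_sub_smul_one c
          · exact hvr'.2 q hq
    · have e : P.wordProd (u ++ [a]) * P.wordProd (b :: v) =
          P.wordProd ((u ++ [a]) ++ b :: v) := by simp [mul_assoc]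
      rw [e]
      refine h.tr_wordProd (hu.append (hv.mono (Set.subset_univ _))) ⟨?_, ?_⟩ (by simp)
      · refine List.isChain_append.2 ⟨hur.1, hvr.1, ?_⟩
        intro q hq r hr
        have hq' : a = q := by simpa using hq
        have hr' : b = r := by simpa using hr
        rw [← hq', ← hr']
        exact hab
      · intro q hq
        rcases List.mem_append.1 hq with hq | hq
        · exact hur.2 q hq
        · exact hvr.2 q hq

/-! ### Tensor independence on words. -/

/-- The product of the letters of a word that have the index `k`. -/
def lettersProd (k : Fin n) (w : List (Fin n × P.Elt)) : P.Elt :=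
  (w.map fun p => if p.1 = k then p.2 else 1).prod

theorem lettersProd_append (k : Fin n) (w v : List (Fin n × P.Elt)) :
    lettersProd k (w ++ v) = lettersProd k w * lettersProd k v := by
  simp [lettersProd]

theorem lettersProd_eq_one {J : Set (Fin n)} {k : Fin n} (hk : k ∉ J) {w : List (Fin n × P.Elt)}
    (hw : P.IsWord N J w) : lettersProd k w = 1 := by
  refine List.prod_eq_one fun x hx => ?_
  obtain ⟨p, hp, rfl⟩ := List.mem_map.1 hx
  rw [if_neg]
  rintro rfl
  exact hk (hw p hp).1

open Classical in
theorem lettersProd_filter {J : Set (Fin n)} {k : Fin n} (hk : k ∈ J)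
    (w : List (Fin n × P.Elt)) :
    lettersProd k (w.filter fun p => decide (p.1 ∈ J)) = lettersProd k w := by
  induction w with
  | nil => rfl
  | cons p w ih =>
    simp only [lettersProd] at ih ⊢
    by_cases hp : p.1 ∈ J
    · simp [hp, ih]
    · have : p.1 ≠ k := fun h => hp (h ▸ hk)
      simp [hp, ih, this]

theorem prod_ofFn_ite {M : Type*} [Monoid M] {n : ℕ} (j : Fin n) (x : M) :
    (List.ofFn fun k => if j = k then x else 1).prod = x := by
  induction n with
  | zero => exact j.elim0
  | succ n ih =>
    rw [List.ofFn_succ, List.prod_cons]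
    refine Fin.cases ?_ (fun i => ?_) j
    · have : (List.ofFn fun i : Fin n => if (0 : Fin (n + 1)) = i.succ then x else 1).prod = 1 := by
        refine List.prod_eq_one fun y hy => ?_
        obtain ⟨i, rfl⟩ := List.mem_ofFn.1 hy
        simp [(Fin.succ_ne_zero i).symm]
      simp [this]
    · simpa using ih i

/-- The word is fed to the definition as an array: row `i` has the `i`-th letter in the column of
its index and `1` elsewhere. -/
theorem TensorIndependent.tr_wordProd (h : P.TensorIndependent N) {w : List (Fin n × P.Elt)}
    (hw : P.IsWord N Set.univ w) : P.tr (P.wordProd w) = ∏ k, P.tr (lettersProd k w) := by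
  have h1 := h w.length (fun k i => if (w.get i).1 = k then (w.get i).2 else 1) (fun k i => by
    split_ifs with hk
    · exact hk ▸ (hw _ (List.get_mem _ _)).2
    · exact one_mem (N k))
  have e : ∀ g : Fin n × P.Elt → P.Elt, (List.ofFn fun i => g (w.get i)) = w.map g := fun g => by
    conv_rhs => rw [← List.ofFn_get w, List.map_ofFn]
    rfl
  simp_rw [prod_ofFn_ite] at h1
  rw [e Prod.snd] at h1
  rw [wordProd, h1]
  exact Finset.prod_congr rfl fun k _ =>
    congrArg (fun l : List P.Elt => P.tr l.prod) (e fun p => if p.1 = k then p.2 else 1)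

/-! ### Commuting squares, first for the generated algebras. -/

/-- It suffices to construct the conditional expectation of the elements of a spanning set. -/
theorem exists_familyAlgebra_of_span {I J : Set (Fin n)} {s t : Set P.Elt}
    (hs : ∀ c ∈ P.familyAlgebra N I, c ∈ Submodule.span ℂ s)
    (ht : ∀ m ∈ P.familyAlgebra N J, m ∈ Submodule.span ℂ t)
    (h : ∀ c ∈ s, ∃ c₀ ∈ P.familyAlgebra N (I ∩ J), ∀ m ∈ t, P.tr (c * m) = P.tr (c₀ * m))
    {c : P.Elt} (hc : c ∈ P.familyAlgebra N I) :
    ∃ c₀ ∈ P.familyAlgebra N (I ∩ J), ∀ m ∈ P.familyAlgebra N J,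
      P.tr (c * m) = P.tr (c₀ * m) := by
  have hc' := hs c hc
  clear hc
  induction hc' using Submodule.span_induction with
  | mem c hc =>
    obtain ⟨c₀, h0, h1⟩ := h c hc
    refine ⟨c₀, h0, fun m hm => ?_⟩
    have hm' := ht m hm
    clear hm
    induction hm' using Submodule.span_induction with
    | mem m hm => exact h1 m hm
    | zero => simp
    | add x y _ _ hx hy => rw [mul_add, mul_add, map_add, map_add, hx, hy]
    | smul r x _ hx => rw [mul_smul_comm, mul_smul_comm, map_smul, map_smul, hx]
  | zero => exact ⟨0, zero_mem _, fun _ _ => rfl⟩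
  | add x y _ _ hx hy =>
    obtain ⟨a, ha, hxa⟩ := hx
    obtain ⟨b, hb, hyb⟩ := hy
    refine ⟨a + b, add_mem ha hb, fun m hm => ?_⟩
    rw [add_mul, add_mul, map_add, map_add, hxa m hm, hyb m hm]
  | smul r x _ hx =>
    obtain ⟨a, ha, hxa⟩ := hx
    refine ⟨r • a, Subalgebra.smul_mem _ ha r, fun m hm => ?_⟩
    rw [smul_mul_assoc, smul_mul_assoc, map_smul, map_smul, hxa m hm]

/-- Free and tensor independent families generate commuting squares of algebras. -/
theorem exists_familyAlgebra_inter (hind : P.FreelyIndependent N ∨ P.TensorIndependent N)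
    {I J : Set (Fin n)} {c : P.Elt} (hc : c ∈ P.familyAlgebra N I) :
    ∃ c₀ ∈ P.familyAlgebra N (I ∩ J), ∀ m ∈ P.familyAlgebra N J,
      P.tr (c * m) = P.tr (c₀ * m) := by
  classical
  rcases hind with hind | hind
  · refine exists_familyAlgebra_of_span (fun _ => mem_span_reducedWords)
      (fun _ => mem_span_reducedWords) ?_ hc
    rintro _ ⟨w, ⟨hw, hwr⟩, rfl⟩
    -- The expectation onto the algebra of `J` kills a reduced word with a letter outside `J` and
    -- fixes the others.
    by_cases hJ : ∃ p ∈ w, p.1 ∉ J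
    · refine ⟨0, zero_mem _, ?_⟩
      rintro _ ⟨v, ⟨hv, hvr⟩, rfl⟩
      rw [zero_mul, map_zero]
      exact hind.tr_wordProd_mul v w hv hvr (hw.mono (Set.subset_univ _)) hwr hJ
    · push Not at hJ
      refine ⟨P.wordProd w, IsWord.wordProd_mem fun p hp =>
        ⟨⟨(hw p hp).1, hJ p hp⟩, (hw p hp).2⟩, fun _ _ => rfl⟩
  · refine exists_familyAlgebra_of_span (fun _ => mem_span_words)
      (fun _ => mem_span_words) ?_ hc
    rintro _ ⟨w, hw, rfl⟩
    let w' := w.filter fun p => decide (p.1 ∈ J)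
    have hw' : P.IsWord N (I ∩ J) w' := fun p hp => by
      obtain ⟨h1, h2⟩ := List.mem_filter.1 hp
      exact ⟨⟨(hw p h1).1, by simpa using h2⟩, (hw p h1).2⟩
    -- In the tensor case the expectation deletes the letters outside `J` and multiplies by the
    -- trace of their product for each such index.
    refine ⟨(∏ k, if k ∈ J then 1 else P.tr (lettersProd k w)) • P.wordProd w',
      Subalgebra.smul_mem _ hw'.wordProd_mem _, ?_⟩
    rintro _ ⟨v, hv, rfl⟩
    have e : ∀ u : List (Fin n × P.Elt), P.wordProd u * P.wordProd v = P.wordProd (u ++ v) :=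
      fun u => by simp
    have hv' := hv.mono (Set.subset_univ J)
    rw [smul_mul_assoc, map_smul, smul_eq_mul, e, e,
      hind.tr_wordProd ((hw.mono (Set.subset_univ _)).append hv'),
      hind.tr_wordProd ((hw'.mono (Set.subset_univ _)).append hv'), ← Finset.prod_mul_distrib]
    refine Finset.prod_congr rfl fun k _ => ?_
    rw [lettersProd_append, lettersProd_append]
    split_ifs with hk
    · rw [one_mul, lettersProd_filter hk]
    · rw [lettersProd_eq_one hk hv, lettersProd_eq_one hk (hw'.mono Set.inter_subset_right),
        mul_one, one_mul, P.tr_one, mul_one]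

/-! ### Commuting squares of von Neumann algebras, by density. -/

theorem preL2_norm_star (x : P.Elt) : ‖P.toPreL2 (star x)‖ = ‖P.toPreL2 x‖ := by
  refine (sq_eq_sq₀ (norm_nonneg _) (norm_nonneg _)).1 ?_
  rw [preL2_norm_sq, preL2_norm_sq, star_star, P.tr_mul_comm]

theorem norm_tr_mul_le_preL2 (x y : P.Elt) :
    ‖P.tr (x * y)‖ ≤ ‖P.toPreL2 x‖ * ‖P.toPreL2 y‖ := by
  have := P.norm_tr_star_mul_le (star x) y
  rwa [star_star, preL2_norm_star] at this

/-- The von Neumann algebra generated by the subalgebras with index in `I`. -/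
abbrev familyVN (N : Fin n → VonNeumannAlgebra H) (I : Set (Fin n)) : VonNeumannAlgebra H :=
  generatedVN (⋃ k ∈ I, (N k : Set (H →L[ℂ] H)))

theorem familyVN_le (hN : ∀ j, N j ≤ P.alg) (I : Set (Fin n)) : familyVN N I ≤ P.alg :=
  P.generatedVN_le fun _ hs => by
    obtain ⟨k, -, hs⟩ := Set.mem_iUnion₂.1 hs
    exact hN k hs

theorem familyVN_mono {I J : Set (Fin n)} (h : I ⊆ J) : familyVN N I ≤ familyVN N J :=
  generatedVN_mono (Set.biUnion_subset_biUnion_left h)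

theorem mem_familyVN_of_mem_familyAlgebra {I : Set (Fin n)} {x : P.Elt}
    (hx : x ∈ P.familyAlgebra N I) : (x : H →L[ℂ] H) ∈ familyVN N I := by
  induction hx using Algebra.adjoin_induction with
  | mem s hs => exact subset_generatedVN _ hs
  | algebraMap r => exact (familyVN N I).toStarSubalgebra.algebraMap_mem r
  | add a b _ _ ha hb => exact add_mem (S := VonNeumannAlgebra H) ha hb
  | mul a b _ _ ha hb => exact mul_mem (S := VonNeumannAlgebra H) ha hb

theorem exists_mem_familyAlgebra_norm_sub_lt (hN : ∀ j, N j ≤ P.alg) {I : Set (Fin n)} {x : P.Elt}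
    (hx : (x : H →L[ℂ] H) ∈ familyVN N I) {ε : ℝ} (hε : 0 < ε) :
    ∃ c ∈ P.familyAlgebra N I, ‖P.toPreL2 (x - c)‖ < ε := by
  refine P.exists_mem_adjoin_norm_sub_lt (fun s hs => ?_) (fun s hs => ?_) hx hε
  · obtain ⟨k, -, hs⟩ := Set.mem_iUnion₂.1 hs
    exact hN k hs
  · obtain ⟨k, hk, hs⟩ := Set.mem_iUnion₂.1 hs
    exact Set.mem_biUnion hk (star_mem (S := VonNeumannAlgebra H) hs)

/-- Commuting squares of von Neumann algebras: an element of the algebra with indices in `I` that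
is orthogonal to the one with indices in `I ∩ J` is orthogonal to the one with indices in `J`. -/
theorem tr_mul_eq_zero_of_inter (hN : ∀ j, N j ≤ P.alg)
    (hind : P.FreelyIndependent N ∨ P.TensorIndependent N) {I J : Set (Fin n)} {x m : P.Elt}
    (hx : (x : H →L[ℂ] H) ∈ familyVN N I)
    (hxo : ∀ y : P.Elt, (y : H →L[ℂ] H) ∈ familyVN N (I ∩ J) → P.tr (x * y) = 0)
    (hm : (m : H →L[ℂ] H) ∈ familyVN N J) : P.tr (x * m) = 0 := by
  have hJ : ∀ m ∈ P.familyAlgebra N J, P.tr (x * m) = 0 := fun m hm => by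
    refine norm_le_zero_iff.1 (le_of_forall_pos_le_add fun δ hδ => ?_)
    -- Two errors of size `ε ‖m‖₂` will occur: one from `x - c`, one from `c₀`.
    let ε : ℝ := δ / (2 * (‖P.toPreL2 m‖ + 1))
    have hε : 0 < ε := by positivity
    obtain ⟨c, hc, hxc⟩ := exists_mem_familyAlgebra_norm_sub_lt hN hx hε
    obtain ⟨c₀, hc₀, h⟩ := exists_familyAlgebra_inter hind (J := J) hc
    have hs := star_mem_familyAlgebra hc₀
    have hle : P.familyAlgebra N (I ∩ J) ≤ P.familyAlgebra N J :=
      Algebra.adjoin_mono fun y hy => Set.biUnion_subset_biUnion_left Set.inter_subset_right hy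
    -- As `c₀` is the projection of `c` and `x` is orthogonal to `c₀`, one has `‖c₀‖₂² = τ(c c₀*) =
    -- -τ((x - c) c₀*) ≤ ε ‖c₀‖₂`.
    have h1 : ‖P.toPreL2 c₀‖ ≤ ε := by
      have h2 : ‖P.toPreL2 c₀‖ ^ 2 ≤ ε * ‖P.toPreL2 c₀‖ := by
        rw [P.preL2_norm_sq, P.tr_mul_comm, ← h _ (hle hs)]
        have h3 : P.tr (c * star c₀) = - P.tr ((x - c) * star c₀) := by
          rw [sub_mul, map_sub, hxo _ (mem_familyVN_of_mem_familyAlgebra hs), zero_sub, neg_neg]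
        rw [h3]
        refine (Complex.re_le_norm _).trans ?_
        rw [norm_neg]
        refine (norm_tr_mul_le_preL2 _ _).trans ?_
        rw [preL2_norm_star]
        gcongr
      by_contra! hlt
      nlinarith [norm_nonneg (P.toPreL2 c₀)]
    have h2 : P.tr (x * m) = P.tr ((x - c) * m) + P.tr (c₀ * m) := by
      rw [← h m hm, sub_mul, map_sub, sub_add_cancel]
    rw [h2, zero_add]
    calc ‖P.tr ((x - c) * m) + P.tr (c₀ * m)‖
        ≤ ‖P.tr ((x - c) * m)‖ + ‖P.tr (c₀ * m)‖ := norm_add_le _ _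
      _ ≤ ε * ‖P.toPreL2 m‖ + ε * ‖P.toPreL2 m‖ := by
        refine add_le_add ((norm_tr_mul_le_preL2 _ _).trans ?_)
          ((norm_tr_mul_le_preL2 _ _).trans ?_) <;> gcongr
      _ ≤ ε * (2 * (‖P.toPreL2 m‖ + 1)) := by nlinarith
      _ = δ := by simp only [ε]; field_simp
  refine norm_le_zero_iff.1 (le_of_forall_pos_le_add fun δ hδ => ?_)
  -- With `x` orthogonal to the algebra of `J`, a second approximation, now of `m`, finishes.
  obtain ⟨c, hc, hmc⟩ := exists_mem_familyAlgebra_norm_sub_lt hN hm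
    (ε := δ / (‖P.toPreL2 x‖ + 1)) (by positivity)
  have h2 : P.tr (x * m) = P.tr (x * (m - c)) := by
    rw [mul_sub, map_sub, hJ c hc, sub_zero]
  rw [h2, zero_add]
  calc ‖P.tr (x * (m - c))‖ ≤ ‖P.toPreL2 x‖ * ‖P.toPreL2 (m - c)‖ := norm_tr_mul_le_preL2 _ _
    _ ≤ (‖P.toPreL2 x‖ + 1) * (δ / (‖P.toPreL2 x‖ + 1)) := by gcongr; linarith
    _ = δ := by field_simp

end NCProbabilitySpace

/-! ### The pairing of `M` with `L₁(M)`. -/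

namespace NCProbabilitySpace

variable {H : Type*} [NormedAddCommGroup H] [InnerProductSpace ℂ H] [CompleteSpace H]
variable (P : NCProbabilitySpace H)

section pairing

theorem L1_induction {p : P.L1 → Prop} (hp : IsClosed {z | p z}) (h : ∀ x, p (P.toL1 x))
    (z : P.L1) : p z :=
  UniformSpace.Completion.induction_on z hp fun a => h (P.toPreL1.symm a)

/-- The functional `z ↦ τ(b z)` on `L₁(M)`, for `b` in `M`. -/
def trMulL1 (b : P.Elt) : P.L1 →L[ℂ] ℂ :=
  ((P.tr ∘ₗ LinearMap.mulLeft ℂ b ∘ₗ P.toPreL1.symm.toLinearMap).mkContinuous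
    ‖(b : H →L[ℂ] H)‖ (fun x => P.norm_tr_mul_le b (P.toPreL1.symm x))).extend
    UniformSpace.Completion.toComplL

@[simp]
theorem trMulL1_toL1 (b x : P.Elt) : P.trMulL1 b (P.toL1 x) = P.tr (b * x) :=
  ContinuousLinearMap.extend_eq _ (UniformSpace.Completion.denseRange_coe)
    (UniformSpace.Completion.isUniformInducing_coe _) _

theorem norm_trMulL1_le (b : P.Elt) (z : P.L1) :
    ‖P.trMulL1 b z‖ ≤ ‖(b : H →L[ℂ] H)‖ * ‖z‖ := by
  induction z using P.L1_induction with
  | hp => exact isClosed_le (by fun_prop) (by fun_prop)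
  | h x =>
    rw [trMulL1_toL1, toL1_apply, UniformSpace.Completion.norm_coe]
    exact P.norm_tr_mul_le b x

theorem trMulL1_add (b c : P.Elt) (z : P.L1) :
    P.trMulL1 (b + c) z = P.trMulL1 b z + P.trMulL1 c z := by
  induction z using P.L1_induction with
  | hp => exact isClosed_eq (by fun_prop) (by fun_prop)
  | h x => simp [add_mul]

theorem trMulL1_smul (r : ℂ) (b : P.Elt) (z : P.L1) :
    P.trMulL1 (r • b) z = r * P.trMulL1 b z := by
  induction z using P.L1_induction with
  | hp => exact isClosed_eq (by fun_prop) (by fun_prop)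
  | h x => simp

theorem trMulL1_one (z : P.L1) : P.trMulL1 1 z = P.trL1 z := by
  induction z using P.L1_induction with
  | hp => exact isClosed_eq (by fun_prop) (by fun_prop)
  | h x => simp [trL1_toL1]

theorem trMulL1_sum {ι : Type*} (s : Finset ι) (c : ι → P.Elt) (z : P.L1) :
    P.trMulL1 (∑ i ∈ s, c i) z = ∑ i ∈ s, P.trMulL1 (c i) z :=
  map_sum (⟨⟨fun b => P.trMulL1 b z, by simpa using P.trMulL1_smul 0 0 z⟩,
    fun b c => P.trMulL1_add b c z⟩ : P.Elt →+ ℂ) c s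

theorem trMulL1_L2toL1 (b : P.Elt) (w : P.L2) :
    P.trMulL1 b (P.L2toL1 w) = ⟪(P.toPreL2 (star b) : P.L2), w⟫_ℂ := by
  induction w using UniformSpace.Completion.induction_on with
  | hp => exact isClosed_eq (by fun_prop) (by fun_prop)
  | ih a =>
    obtain ⟨a, rfl⟩ := P.toPreL2.surjective a
    rw [L2toL1_coe, trMulL1_toL1, UniformSpace.Completion.inner_coe, preL2_inner, star_star]

/-- The unit ball of `M` norms `L₁(M)`: an approximate polar part of a bounded approximant `x` of
`z` nearly attains `‖x‖₁`. The errors of approximating, norming and pairing are `δ / 3` each. -/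
theorem eq_zero_of_trMulL1_eq_zero {z : P.L1} (h : ∀ b, P.trMulL1 b z = 0) : z = 0 := by
  refine norm_le_zero_iff.1 (le_of_forall_pos_le_add fun δ hδ => ?_)
  obtain ⟨a, ha⟩ := Metric.denseRange_iff.1
    (UniformSpace.Completion.denseRange_coe (α := P.PreL1)) z (δ / 3) (by positivity)
  obtain ⟨x, rfl⟩ := P.toPreL1.surjective a
  rw [← toL1_apply, dist_eq_norm] at ha
  obtain ⟨b, hb1, hb⟩ := P.exists_tr_modulus_le x (ε := δ / 3) (by positivity)
  have h1 : (P.tr (b * x)).re ≤ δ / 3 := by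
    have h2 : P.tr (b * x) = -P.trMulL1 b (z - P.toL1 x) := by
      rw [map_sub, h, trMulL1_toL1, zero_sub, neg_neg]
    rw [h2]
    refine (Complex.re_le_norm _).trans ?_
    rw [norm_neg]
    refine (P.norm_trMulL1_le b _).trans ?_
    exact (mul_le_of_le_one_left (norm_nonneg _) hb1).trans ha.le
  have h3 : ‖P.toL1 x‖ = (P.tr (P.modulus x)).re := by
    rw [toL1_apply, UniformSpace.Completion.norm_coe, preL1_norm]
  have h4 : ‖z‖ ≤ ‖z - P.toL1 x‖ + ‖P.toL1 x‖ := by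
    simpa using norm_add_le (z - P.toL1 x) (P.toL1 x)
  linarith

/-- An element of `L₁(M)` that is bounded as a functional for the `2`-norm is in `L₂(M)`. -/
theorem exists_L2toL1_eq {z : P.L1} {C : ℝ} (hC : 0 ≤ C)
    (h : ∀ b, ‖P.trMulL1 b z‖ ≤ C * ‖P.toPreL2 b‖) : ∃ v : P.L2, P.L2toL1 v = z ∧ ‖v‖ ≤ C := by
  -- The Riesz vector sits in the conjugate linear slot, so the star and the conjugation make the
  -- functional linear with `⟪v, b⟫ = φ b`.
  let φ : P.Elt →ₗ[ℂ] ℂ :=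
    { toFun := fun b => starRingEnd ℂ (P.trMulL1 (star b) z)
      map_add' := fun b c => by rw [star_add, trMulL1_add, map_add]
      map_smul' := fun r b => by
        rw [star_smul, trMulL1_smul, map_mul, RCLike.star_def, Complex.conj_conj]
        rfl }
  obtain ⟨v, hv, hφ⟩ := P.exists_inner_eq φ hC fun b => by
    change ‖starRingEnd ℂ (P.trMulL1 (star b) z)‖ ≤ _
    rw [RCLike.norm_conj, ← preL2_norm_star b]
    exact h _
  refine ⟨v, sub_eq_zero.1 (P.eq_zero_of_trMulL1_eq_zero fun b => ?_), hv⟩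
  rw [map_sub, trMulL1_L2toL1, ← inner_conj_symm, hφ]
  change starRingEnd ℂ (starRingEnd ℂ (P.trMulL1 (star (star b)) z)) - _ = 0
  rw [star_star, Complex.conj_conj, sub_self]

/-- Pairing with a bounded `c` is continuous for the 1-norm, so orthogonality to `N` passes to the
closure. This removes the `y_j` although they may be outside `L₂`. -/
theorem trMulL1_eq_zero_of_mem_L1Sub {N : VonNeumannAlgebra H} {c : P.Elt}
    (hc : ∀ m : P.Elt, (m : H →L[ℂ] H) ∈ N → P.tr (c * m) = 0) {z : P.L1} (hz : z ∈ P.L1Sub N) :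
    P.trMulL1 c z = 0 := by
  have hcl : IsClosed {z : P.L1 | P.trMulL1 c z = 0} := isClosed_eq (by fun_prop) (by fun_prop)
  refine closure_minimal ?_ hcl hz
  rintro _ ⟨m, hm, rfl⟩
  exact (P.trMulL1_toL1 c m).trans (hc m hm)

theorem trSq_L2toL1 (w : P.L2) : P.trSq (P.L2toL1 w) = ENNReal.ofReal (‖w‖ ^ 2) := by
  refine le_antisymm (iInf₂_le (f := fun v (_ : P.L2toL1 v = P.L2toL1 w) => ENNReal.ofReal (‖v‖ ^ 2)) w rfl)
    (le_iInf₂ fun v hv => ?_)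
  rw [P.L2toL1_injective hv]

theorem exists_L2toL1_eq_of_trSq_ne_top {z : P.L1} (hz : P.trSq z ≠ ⊤) :
    ∃ w : P.L2, P.L2toL1 w = z := by
  by_contra! h
  refine hz ?_
  simp [trSq, h]

end pairing

/-! ### Martingale decomposition and the Efron-Stein inequality. -/

variable {P} {n : ℕ} {N : Fin n → VonNeumannAlgebra H}

theorem eq_zero_of_preL2_norm_eq_zero {z : P.Elt} (h : ‖P.toPreL2 z‖ = 0) : z = 0 := by
  refine P.tr_faithful z ?_
  rw [← preL2_inner, inner_self_eq_norm_sq_to_K, h]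
  simp

/-- The algebra generated by the empty set is the scalars, so `x` is 2-norm close to some `r • 1`.
As `z = x - τ(x)1` is orthogonal to `1`, it satisfies `‖z‖₂² = τ(z* (x - r1)) ≤ ‖z‖₂ δ`. -/
theorem eq_tr_smul_one_of_mem_familyVN_empty (hN : ∀ j, N j ≤ P.alg) {x : P.Elt}
    (hx : (x : H →L[ℂ] H) ∈ familyVN N ∅) : x = P.tr x • 1 := by
  refine sub_eq_zero.1 (eq_zero_of_preL2_norm_eq_zero
    (le_antisymm (le_of_forall_pos_le_add fun δ hδ => ?_) (norm_nonneg _)))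
  obtain ⟨c, hc, hxc⟩ := exists_mem_familyAlgebra_norm_sub_lt hN hx hδ
  rw [familyAlgebra] at hc
  simp only [Set.mem_empty_iff_false, Set.iUnion_of_empty, Set.iUnion_empty,
    Set.ofPred_false, Algebra.adjoin_empty, Algebra.mem_bot, Set.mem_range] at hc
  obtain ⟨r, rfl⟩ := hc
  rw [Algebra.algebraMap_eq_smul_one] at hxc
  set z := x - P.tr x • 1 with hz
  have h1 : P.tr (star z) = 0 := by rw [tr_star, hz, tr_sub_smul_one, map_zero]
  have h2 : star z * z = star z * (x - r • 1) + (r - P.tr x) • star z := by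
    conv_lhs => rw [show z = (x - r • 1) + (r - P.tr x) • (1 : P.Elt) by rw [hz, sub_smul]; abel]
    rw [show z = (x - r • 1) + (r - P.tr x) • (1 : P.Elt) by rw [hz, sub_smul]; abel, mul_add,
      mul_smul_comm, mul_one]
  have h3 : ‖P.toPreL2 z‖ ^ 2 ≤ ‖P.toPreL2 z‖ * δ := by
    rw [preL2_norm_sq, h2, map_add, map_smul, h1, smul_zero, add_zero]
    refine (Complex.re_le_norm _).trans ((P.norm_tr_star_mul_le _ _).trans ?_)
    gcongr
  rw [zero_add]
  by_contra! hlt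
  nlinarith [norm_nonneg (P.toPreL2 z)]

/-- The martingale decomposition of a centred element: its terms are orthogonal to the algebras
generated by all but one of the members of the family. -/
theorem exists_orthogonal_decomposition (hn : 1 ≤ n) (hN : ∀ j, N j ≤ P.alg)
    (hind : P.FreelyIndependent N ∨ P.TensorIndependent N) (b : P.Elt) :
    ∃ c : Fin n → P.Elt, b - P.tr b • 1 = ∑ j, c j ∧
      (∀ j, ∀ m : P.Elt, (m : H →L[ℂ] H) ∈ familyVN N {k | k ≠ j} → P.tr (c j * m) = 0) ∧
      ∑ j, ‖P.toPreL2 (c j)‖ ^ 2 ≤ ‖P.toPreL2 b‖ ^ 2 := by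
  choose E hE hEo using fun (I : Set (Fin n)) (x : P.Elt) => P.exists_condExp (familyVN_le hN I) x
  let I : ℕ → Set (Fin n) := fun j => {k | j ≤ k}
  -- The reverse martingale starts at `b` itself, which need not lie in the algebra generated by the
  -- whole family.
  let B : ℕ → P.Elt := fun j => Nat.rec b (fun j x => E (I (j + 1)) x) j
  have hB0 : B 0 = b := rfl
  have hB : ∀ j, B (j + 1) = E (I (j + 1)) (B j) := fun j => rfl
  have hmem : ∀ j, (B (j + 1) : H →L[ℂ] H) ∈ familyVN N (I (j + 1)) := fun j => hE _ _
  have hort : ∀ j, ∀ m : P.Elt, (m : H →L[ℂ] H) ∈ familyVN N (I (j + 1)) →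
      P.tr ((B j - B (j + 1)) * m) = 0 := fun j => hEo _ _
  have htr : ∀ j, P.tr (B j) = P.tr b := fun j => by
    induction j with
    | zero => rfl
    | succ j ih =>
      have := hort j 1 (one_mem (familyVN N (I (j + 1))))
      rw [mul_one, map_sub, ih, sub_eq_zero] at this
      exact this.symm
  have hsplit : ∀ j, ‖P.toPreL2 (B j - B (j + 1))‖ ^ 2 =
      ‖P.toPreL2 (B j)‖ ^ 2 - ‖P.toPreL2 (B (j + 1))‖ ^ 2 := fun j => by
    have h := norm_add_sq (𝕜 := ℂ) (P.toPreL2 (B (j + 1))) (P.toPreL2 (B j - B (j + 1)))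
    have h0 : P.tr (star (B (j + 1)) * (B j - B (j + 1))) = 0 := by
      rw [P.tr_mul_comm]
      exact hort j _ (star_mem (S := VonNeumannAlgebra H) (hmem j))
    rw [preL2_inner, h0, ← map_add, add_sub_cancel] at h
    simp only [map_zero, mul_zero, add_zero] at h
    linarith
  have hlast : B n = P.tr b • 1 := by
    obtain ⟨m, rfl⟩ : ∃ m, n = m + 1 := ⟨n - 1, by omega⟩
    have h := hmem m
    -- Indices run from `0` to `n - 1`, so the last expectation is onto the scalars.
    have hI : I (m + 1) = ∅ := Set.eq_empty_of_forall_notMem fun k hk => absurd k.2 (not_lt.2 hk)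
    rw [hI] at h
    rw [← htr (m + 1)]
    exact eq_tr_smul_one_of_mem_familyVN_empty hN h
  refine ⟨fun j => B j - B (j + 1), ?_, fun j m hm => ?_, ?_⟩
  · rw [Fin.sum_univ_eq_sum_range (fun j => B j - B (j + 1)) n, Finset.sum_range_sub', hlast, hB0]
  · obtain ⟨j, hj⟩ := j
    cases j with
    -- `I 1` is already the set of all indices other than `0`, so no independence is needed.
    | zero =>
      refine hort 0 m ?_
      convert hm using 2
      ext k
      simp only [I, Set.mem_ofPred_eq, ne_eq, Fin.ext_iff]
      omega
    | succ j =>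
      have hle : familyVN N (I (j + 1 + 1)) ≤ familyVN N (I (j + 1)) :=
        familyVN_mono fun k hk => (Nat.le_succ _).trans hk
      -- The square is that of `I (j + 1)` and the complement of `j + 1`; they meet in `I (j + 2)`,
      -- to which the difference is orthogonal by construction.
      refine tr_mul_eq_zero_of_inter hN hind (I := I (j + 1)) ?_ (fun y hy => ?_) hm
      · exact sub_mem (hmem j) (hle (hmem (j + 1)))
      · refine hort (j + 1) y ?_
        convert hy using 2
        ext k
        simp only [I, Set.mem_inter_iff, Set.mem_ofPred_eq, ne_eq, Fin.ext_iff]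
        omega
  · rw [Fin.sum_univ_eq_sum_range (fun j => ‖P.toPreL2 (B j - B (j + 1))‖ ^ 2) n]
    simp_rw [hsplit]
    rw [Finset.sum_range_sub', hB0]
    have := sq_nonneg ‖P.toPreL2 (B n)‖
    linarith

/-- The Efron-Stein inequality for approximations `Y j` that do not depend on the `j`-th member of
an independent family. -/
theorem var_le_sum_trSq (hn : 1 ≤ n) (hN : ∀ j, N j ≤ P.alg)
    (hind : P.FreelyIndependent N ∨ P.TensorIndependent N) (y : P.L1) {Y : Fin n → P.L1}
    (hYmem : ∀ j, Y j ∈ P.L1Sub (familyVN N {k | k ≠ j})) :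
    P.var y ≤ ∑ j, P.trSq (y - Y j) := by
  rw [var]
  by_cases htop : ∑ j, P.trSq (y - Y j) = ⊤
  · exact htop ▸ le_top
  have hw : ∀ j, ∃ w : P.L2, P.L2toL1 w = y - Y j := fun j =>
    P.exists_L2toL1_eq_of_trSq_ne_top fun h =>
      htop (ENNReal.sum_eq_top.2 ⟨j, Finset.mem_univ j, h⟩)
  choose w hw using hw
  have hbound : ∀ b, ‖P.trMulL1 b (y - P.trL1 y • P.toL1 1)‖ ≤
      √(∑ j, ‖w j‖ ^ 2) * ‖P.toPreL2 b‖ := fun b => by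
    obtain ⟨c, hc, hco, hcn⟩ := exists_orthogonal_decomposition hn hN hind b
    have h1 : P.trMulL1 b (y - P.trL1 y • P.toL1 1) =
        ∑ j, ⟪(P.toPreL2 (star (c j)) : P.L2), w j⟫_ℂ := by
      -- Centring is moved from `y` to `b`, where the decomposition is available.
      have h2 : P.trMulL1 (b - P.tr b • 1) y = P.trMulL1 b y - P.tr b * P.trL1 y := by
        rw [sub_eq_add_neg, ← neg_smul, trMulL1_add, trMulL1_smul, trMulL1_one]
        ring
      rw [map_sub, map_smul, trMulL1_toL1, mul_one, smul_eq_mul, mul_comm, ← h2, hc, trMulL1_sum]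
      refine Finset.sum_congr rfl fun j _ => ?_
      rw [← trMulL1_L2toL1, hw, map_sub, P.trMulL1_eq_zero_of_mem_L1Sub (hco j) (hYmem j), sub_zero]
    rw [h1]
    calc ‖∑ j, ⟪(P.toPreL2 (star (c j)) : P.L2), w j⟫_ℂ‖
        ≤ ∑ j, ‖w j‖ * ‖P.toPreL2 (c j)‖ := by
          refine norm_sum_le_of_le _ fun j _ => (norm_inner_le_norm _ _).trans_eq ?_
          rw [UniformSpace.Completion.norm_coe, preL2_norm_star, mul_comm]
      _ ≤ √(∑ j, ‖w j‖ ^ 2) * √(∑ j, ‖P.toPreL2 (c j)‖ ^ 2) :=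
          Real.sum_mul_le_sqrt_mul_sqrt _ _ _
      _ ≤ √(∑ j, ‖w j‖ ^ 2) * ‖P.toPreL2 b‖ := by
          gcongr
          exact Real.sqrt_le_iff.2 ⟨norm_nonneg _, hcn⟩
  -- The bound against all `b` itself puts `y - τ(y)1` in `L₂`; this was not assumed.
  obtain ⟨v, hv, hvn⟩ := P.exists_L2toL1_eq (Real.sqrt_nonneg _) hbound
  rw [← hv, trSq_L2toL1]
  simp_rw [← hw, trSq_L2toL1]
  rw [← ENNReal.ofReal_sum_of_nonneg fun j _ => sq_nonneg ‖w j‖]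
  refine ENNReal.ofReal_le_ofReal ?_
  rw [← Real.sq_sqrt (Finset.sum_nonneg fun j _ => sq_nonneg ‖w j‖)]
  gcongr

end NCProbabilitySpace

theorem theorem3p3 {H : Type*} [NormedAddCommGroup H] [InnerProductSpace ℂ H] [CompleteSpace H]
    (P : NCProbabilitySpace H) {n : ℕ} (hn : 1 ≤ n)
    (N : Fin n → VonNeumannAlgebra H) (hN : ∀ j, N j ≤ P.alg)
    (hind : P.FreelyIndependent N ∨ P.TensorIndependent N)
    (x : Fin n → selfAdjoint P.L1) (hx : ∀ j, (x j : P.L1) ∈ P.L1Sub (N j))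
    (f : (Fin n → selfAdjoint P.L1) → selfAdjoint P.L1)
    (g : ∀ j : Fin n, (∀ k : {k : Fin n // k ≠ j}, P.L1Sub (N k)) →
      P.L1Sub (generatedVN (⋃ k ∈ {k : Fin n | k ≠ j}, (N k : Set (H →L[ℂ] H)))))
    (hg : ∀ j, IsSelfAdjoint (g j (fun k => ⟨x k, hx k⟩) : P.L1)) :
    P.var (f x) ≤
      ∑ j, P.trSq ((f x : P.L1) - (g j (fun k => ⟨x k, hx k⟩) : P.L1)) :=
  NCProbabilitySpace.var_le_sum_trSq hn hN hind _
    fun j => (g j fun k => ⟨x k, hx k⟩).2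

end
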